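/- Let $k$ be a field and let $\Gamma$ be a simple graph with vertex set $\{1,\dots,n\}$ and edge set $E$. Let $V$ be the $k$-vector space with basis $\{u_i : 1\le i\le n\}\cup\{u_{ij} : (ij)\in E\}$, where $u_{ij}=u_{ji}$, and put $u_{pq}=0$ for $(pq)\notin E$. Let $Q(\Gamma)$ be the quadratic algebra with space of generators $V$ and, for all pairwise different indices $i,j,k,l$, the relations $$[u_i,u_j]-u_{ij}(u_i-u_j),\qquad [u_i,u_{jk}]+[u_{ik},u_j]+[u_{ik},u_{jk}]-u_{ij}(u_{ik}-u_{jk}),\qquad [u_{ij},u_{kl}],$$ and let $B(\Gamma)$ be the quadratic algebra with the same generators and the relations $$[u_i,u_j],\qquad [u_i,u_{jk}]+[u_{ik},u_j],\qquad [u_{ij},u_{kl}].$$ For a quadratic algebra $A=T(V)/(R)$, $R\subseteq V\otimes V$, let $A^!=T(V^*)/(R^\perp)$ be its quadratic dual, and let $A^!(z)=\sum_d \dim_k (A^!)_d\, z^d$ be the Hilbert series of $A^!$. For $p\ge 0$ let $L_p$ be the set of all $p$-element sets $W$ of pairwise disjoint edges of $\Gamma$, and let $l_p=|L_p|$. For $W\in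 L_p$ let $r_W$ be the number of vertices $m\in\{1,\dots,n\}$ that lie on no edge of $W$ and are such that for every edge $(ij)\in W$ with $i>j$ either $m<i$, or $(mi)\notin E$, or $(mj)\notin E$. Suppose that no two different triangles of $\Gamma$ have a common vertex. Then the Hilbert series of $Q(\Gamma)^!$ and of $B(\Gamma)^!$ are both equal to the polynomial $$p(z)=\sum_{p=0}^{\lfloor n/2\rfloor} z^p\sum_{W\in L_p}(1+z)^{r_W}.$$ In particular, if $\Gamma$ contains no triangle, then $$p(z)=\sum_{p=0}^{\lfloor n/2\rfloor} l_p\, z^p(1+z)^{n-2p}.$$ -/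

import Mathlib

open scoped TensorProduct

/-- The canonical linear map `V ⊗ V → T(V)`, `v ⊗ w ↦ v w`, onto the degree-two part of the tensor
algebra. -/
noncomputable def tensorSquareToAlg (k V : Type*) [Field k] [AddCommGroup V] [Module k V] :
    V ⊗[k] V →ₗ[k] TensorAlgebra k V :=
  LinearMap.mul' k (TensorAlgebra k V) ∘ₗ
    TensorProduct.map (TensorAlgebra.ι k) (TensorAlgebra.ι k)

/-- The quadratic algebra `T(V) / (R)` with space of generators `V` and space of quadratic
relations `R ⊆ V ⊗ V`. -/
abbrev QuadAlg {k V : Type*} [Field k] [AddCommGroup V] [Module k V]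
    (R : Submodule k (V ⊗[k] V)) : Type _ :=
  RingQuot (fun a b : TensorAlgebra k V => ∃ r ∈ R, a = tensorSquareToAlg k V r ∧ b = 0)

namespace QuadAlg

variable {k V : Type*} [Field k] [AddCommGroup V] [Module k V]

/-- The generators of `T(V) / (R)`: the linear map `V → T(V) / (R)`. -/
noncomputable def gen (R : Submodule k (V ⊗[k] V)) : V →ₗ[k] QuadAlg R :=
  (RingQuot.mkAlgHom k
    (fun a b : TensorAlgebra k V =>
      ∃ r ∈ R, a = tensorSquareToAlg k V r ∧ b = 0)).toLinearMap ∘ₗ TensorAlgebra.ι k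

/-- The graded component of degree `d` of `T(V) / (R)`: the span of all products of `d`
generators, that is, the image of `V ^ {⊗ d}`. -/
noncomputable def component (R : Submodule k (V ⊗[k] V)) (d : ℕ) : Submodule k (QuadAlg R) :=
  LinearMap.range (gen R) ^ d

/-- The graded components are finite-dimensional when there are finitely many generators, so that
`Module.finrank` is their dimension. -/
theorem component_finite [Module.Finite k V] (R : Submodule k (V ⊗[k] V)) (d : ℕ) :
    Module.Finite k (component R d) :=
  Module.Finite.iff_fg.mpr ((Module.Finite.iff_fg.mp inferInstance).pow d)

/-- The Hilbert series `∑ dim A_d z ^ d` of the quadratic algebra `A = T(V) / (R)`. -/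
noncomputable def hilbertSeries (R : Submodule k (V ⊗[k] V)) : PowerSeries ℕ :=
  PowerSeries.mk fun d => Module.finrank k (component R d)

/-- The relations of the quadratic dual algebra `A^! = T(V*) / (R^⊥)` of `A = T(V) / (R)`:
`R^⊥ ⊆ V* ⊗ V*` is the annihilator of `R` under the pairing
`⟨f ⊗ g, v ⊗ w⟩ = f v * g w`. -/
noncomputable def dualRel (R : Submodule k (V ⊗[k] V)) :
    Submodule k (Module.Dual k V ⊗[k] Module.Dual k V) :=
  R.dualAnnihilator.comap (TensorProduct.dualDistrib k V V)

end QuadAlg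

namespace GraphAlg

variable (k : Type*) [Field k] {n : ℕ} (Γ : SimpleGraph (Fin n))

/-- The space with basis `u_i` (`i` a vertex) and `u_{ij}` (`ij` an edge, an unordered pair). -/
abbrev Gens : Type _ := (Fin n ⊕ Γ.edgeSet) →₀ k

/-- The generator `u_i`. -/
noncomputable def u (i : Fin n) : Gens k Γ := Finsupp.single (Sum.inl i) 1

open scoped Classical in
/-- The generator `u_{ij}`, with `u_{ij} = 0` when `ij` is not an edge. -/
noncomputable def uu (i j : Fin n) : Gens k Γ :=
  if h : s(i, j) ∈ Γ.edgeSet then Finsupp.single (Sum.inr ⟨s(i, j), h⟩) 1 else 0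

/-- The commutator `[v, w]` as an element of `V ⊗ V`. -/
noncomputable def comm {k V : Type*} [Field k] [AddCommGroup V] [Module k V] (v w : V) :
    V ⊗[k] V :=
  v ⊗ₜ[k] w - w ⊗ₜ[k] v

/-- The space of relations of `Q(Γ)`. -/
noncomputable def relQ : Submodule k (Gens k Γ ⊗[k] Gens k Γ) :=
  Submodule.span k
    ({x | ∃ i j : Fin n, i ≠ j ∧
        x = comm (u k Γ i) (u k Γ j) - uu k Γ i j ⊗ₜ[k] (u k Γ i - u k Γ j)} ∪
     {x | ∃ i j l : Fin n, i ≠ j ∧ i ≠ l ∧ j ≠ l ∧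
        x = comm (u k Γ i) (uu k Γ j l) + comm (uu k Γ i l) (u k Γ j)
          + comm (uu k Γ i l) (uu k Γ j l)
          - uu k Γ i j ⊗ₜ[k] (uu k Γ i l - uu k Γ j l)} ∪
     {x | ∃ i j l m : Fin n, i ≠ j ∧ i ≠ l ∧ i ≠ m ∧ j ≠ l ∧ j ≠ m ∧ l ≠ m ∧
        x = comm (uu k Γ i j) (uu k Γ l m)})

/-- The space of relations of `B(Γ)`. -/
noncomputable def relB : Submodule k (Gens k Γ ⊗[k] Gens k Γ) :=
  Submodule.span k
    ({x | ∃ i j : Fin n, i ≠ j ∧ x = comm (u k Γ i) (u k Γ j)} ∪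
     {x | ∃ i j l : Fin n, i ≠ j ∧ i ≠ l ∧ j ≠ l ∧
        x = comm (u k Γ i) (uu k Γ j l) + comm (uu k Γ i l) (u k Γ j)} ∪
     {x | ∃ i j l m : Fin n, i ≠ j ∧ i ≠ l ∧ i ≠ m ∧ j ≠ l ∧ j ≠ m ∧ l ≠ m ∧
        x = comm (uu k Γ i j) (uu k Γ l m)})

/-- No two different triangles have a common vertex. -/
def NoOverlappingTriangles : Prop :=
  ∀ s t : Finset (Fin n), Γ.IsNClique 3 s → Γ.IsNClique 3 t → s ≠ t → Disjoint s t

open scoped Classical in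
/-- `L_p`: the sets of `p` pairwise disjoint edges. -/
noncomputable def matchings (p : ℕ) : Finset (Finset (Sym2 (Fin n))) :=
  {W | W.card = p ∧ (∀ e ∈ W, e ∈ Γ.edgeSet) ∧
    ∀ e ∈ W, ∀ f ∈ W, e ≠ f → ∀ v, v ∈ e → v ∉ f}

open scoped Classical in
/-- `R_W`: the vertices `m` outside the edges of `W` such that no edge `ij` of `W` with `i > j`
forms a triangle `m, i, j` with `m > i`. -/
noncomputable def admissible (W : Finset (Sym2 (Fin n))) : Finset (Fin n) :=
  {m | (∀ e ∈ W, m ∉ e) ∧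
    ∀ i j : Fin n, s(i, j) ∈ W → j < i → m < i ∨ ¬ Γ.Adj m i ∨ ¬ Γ.Adj m j}

end GraphAlg

/-! ### Quadratic algebras: vanishing of the relations and the universal property. -/

namespace QuadAlg

variable {k V : Type*} [Field k] [AddCommGroup V] [Module k V]

/-! Both spaces of relations belong to one family `rel k Γ ε`, with ε = 1 for Q(Γ) and ε = 0 for
B(Γ), and the whole argument is uniform in ε. The dual algebra is generated by the dual basis: x_i
for the vertices, y_e for the edges. Its relations (`IsDualSystem`) say that generators with
disjoint supports anticommute; that x_i kills, from the left, every generator whose support contains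
i; that y_e b = ε x_w b when e = {v, w} and b is supported at v; and that x_a y_bc + x_b y_ac + x_c
y_ab = 0 for each triangle a < b < c.

Spanning (`component_eq_reducedSpan`). The first relations reduce every product to monomials with
pairwise disjoint supports, and the triangle relation eliminates x_c y_ab. The surviving monomials
are indexed by the sets satisfying `IsReduced`. This half works for every graph.

Independence (`linearIndependent_monomial`). Take the space with basis all finite sets of
generators. Let x_i act by a fermionic creation operator that kills the sets whose support contains
i, and y_ij by its creation operator plus ε (x_i p_j + x_j p_i), where p_v projects to the sets
touching v. Every relation but the triangle one holds there. The triangle expression is an operator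
`Triangle.op` free of ε, so the algebra acts on the quotient by the images of these operators
(`isDualSystem_opQ`). That the relations listed imply all of R^⊥, so that there is an action at all,
is `IsDualSystem.quadratic_eq_zero`. To see that reduced vectors stay independent in the quotient,
each triangle T gets an operator `Triangle.reduce` that kills the image of its own `op` and fixes
reduced vectors. As different triangles are disjoint, it commutes with the `op` of every other
triangle, so the product over all triangles descends to the quotient
(`triangleSpan_le_ker_normalForm`). Applied to the vacuum, reduced monomials give unit multiples of
distinct basis vectors.

Counting (`sum_isReduced`). A reduced set is a matching W together with any subset of the vertices
admissible for W, which contributes z^p (1 + z)^{r_W}. -/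

/-- The linear map `V ⊗ V → E`, `v ⊗ w ↦ ρ v * ρ w`. -/
noncomputable def mulMap {E : Type*} [Ring E] [Algebra k E] (ρ : V →ₗ[k] E) : V ⊗[k] V →ₗ[k] E :=
  LinearMap.mul' k E ∘ₗ TensorProduct.map ρ ρ

theorem mulMap_tmul {E : Type*} [Ring E] [Algebra k E] (ρ : V →ₗ[k] E) (v w : V) :
    mulMap ρ (v ⊗ₜ w) = ρ v * ρ w := by
  simp [mulMap]

theorem tensorSquareToAlg_tmul (v w : V) :
    tensorSquareToAlg k V (v ⊗ₜ w) = TensorAlgebra.ι k v * TensorAlgebra.ι k w := by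
  simp [tensorSquareToAlg]

theorem mulMap_gen (R : Submodule k (V ⊗[k] V)) {r : V ⊗[k] V} (hr : r ∈ R) :
    mulMap (gen R) r = 0 := by
  have h1 : mulMap (gen R) =
      (RingQuot.mkAlgHom k (fun a b : TensorAlgebra k V =>
        ∃ r ∈ R, a = tensorSquareToAlg k V r ∧ b = 0)).toLinearMap ∘ₗ tensorSquareToAlg k V := by
    refine TensorProduct.ext' fun v w => ?_
    rw [mulMap_tmul]
    rw [LinearMap.comp_apply, tensorSquareToAlg_tmul]
    exact (map_mul (RingQuot.mkAlgHom k (fun a b : TensorAlgebra k V =>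
        ∃ r ∈ R, a = tensorSquareToAlg k V r ∧ b = 0)) _ _).symm
  rw [h1]
  have h2 := RingQuot.mkAlgHom_rel k (s := fun a b : TensorAlgebra k V =>
    ∃ r ∈ R, a = tensorSquareToAlg k V r ∧ b = 0) ⟨r, hr, rfl, rfl⟩
  simpa using h2

/-- The universal property of `T(V) / (R)`. -/
noncomputable def lift {E : Type*} [Ring E] [Algebra k E] (R : Submodule k (V ⊗[k] V))
    (ρ : V →ₗ[k] E)
    (h : ∀ r ∈ R, mulMap ρ r = 0) : QuadAlg R →ₐ[k] E :=
  RingQuot.liftAlgHom k ⟨TensorAlgebra.lift k ρ, by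
    rintro _ _ ⟨r, hr, rfl, rfl⟩
    have h1 : mulMap ρ =
        (TensorAlgebra.lift k ρ).toLinearMap ∘ₗ tensorSquareToAlg k V := by
      refine TensorProduct.ext' fun v w => ?_
      simp [tensorSquareToAlg_tmul, mulMap_tmul]
    have := h r hr
    rw [h1] at this
    simpa using this⟩

theorem lift_gen {E : Type*} [Ring E] [Algebra k E] (R : Submodule k (V ⊗[k] V))
    (ρ : V →ₗ[k] E)
    (h : ∀ r ∈ R, mulMap ρ r = 0) (v : V) :
    lift R ρ h (gen R v) = ρ v := by
  simp [lift, gen]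

end QuadAlg

/-! ### The one-parameter family of relations and the relations of its dual. -/

namespace GraphAlg

variable (k : Type*) [Field k] {n : ℕ} (Γ : SimpleGraph (Fin n))

/-- The common deformation of the relations of `Q(Γ)` (at `ε = 1`) and `B(Γ)` (at `ε = 0`). -/
noncomputable def rel (ε : k) : Submodule k (Gens k Γ ⊗[k] Gens k Γ) :=
  Submodule.span k
    ({x | ∃ i j : Fin n, i ≠ j ∧
        x = comm (u k Γ i) (u k Γ j) - ε • (uu k Γ i j ⊗ₜ[k] (u k Γ i - u k Γ j))} ∪
     {x | ∃ i j l : Fin n, i ≠ j ∧ i ≠ l ∧ j ≠ l ∧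
        x = comm (u k Γ i) (uu k Γ j l) + comm (uu k Γ i l) (u k Γ j)
          + ε • (comm (uu k Γ i l) (uu k Γ j l)
          - uu k Γ i j ⊗ₜ[k] (uu k Γ i l - uu k Γ j l))} ∪
     {x | ∃ i j l m : Fin n, i ≠ j ∧ i ≠ l ∧ i ≠ m ∧ j ≠ l ∧ j ≠ m ∧ l ≠ m ∧
        x = comm (uu k Γ i j) (uu k Γ l m)})

theorem relQ_eq_rel : relQ k Γ = rel k Γ 1 := by
  have key (a b c : Gens k Γ ⊗[k] Gens k Γ) : a + b - c = a + (b - c) := add_sub_assoc a b c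
  simp only [relQ, rel, one_smul, key]

theorem relB_eq_rel : relB k Γ = rel k Γ 0 := by
  have key (a : Gens k Γ ⊗[k] Gens k Γ) : a - 0 = a := sub_zero a
  simp only [relB, rel, zero_smul, key, add_zero]

variable {k Γ}

theorem uu_of_adj {i j : Fin n} (h : Γ.Adj i j) :
    uu k Γ i j = Finsupp.single (Sum.inr ⟨s(i, j), h⟩) 1 := by
  rw [uu, dif_pos (show s(i, j) ∈ Γ.edgeSet from h)]

theorem uu_of_not_adj {i j : Fin n} (h : ¬ Γ.Adj i j) : uu k Γ i j = 0 := by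
  rw [uu, dif_neg]
  simpa using h

theorem uu_symm (i j : Fin n) : uu k Γ i j = uu k Γ j i := by
  by_cases h : Γ.Adj i j
  · rw [uu_of_adj h, uu_of_adj h.symm]
    congr 3
    exact Sym2.eq_swap
  · rw [uu_of_not_adj h, uu_of_not_adj fun h' => h h'.symm]

/-- An annihilator need only be tested on a spanning set, so membership in R^⊥ becomes three
families of scalar identities. -/
theorem mem_dualRel_rel {ε : k}
    {f : Module.Dual k (Gens k Γ) ⊗[k] Module.Dual k (Gens k Γ)} :
    f ∈ QuadAlg.dualRel (rel k Γ ε) ↔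
      (∀ i j, i ≠ j → TensorProduct.dualDistrib k _ _ f
        (comm (u k Γ i) (u k Γ j) - ε • (uu k Γ i j ⊗ₜ[k] (u k Γ i - u k Γ j))) = 0) ∧
      (∀ i j l, i ≠ j → i ≠ l → j ≠ l → TensorProduct.dualDistrib k _ _ f
        (comm (u k Γ i) (uu k Γ j l) + comm (uu k Γ i l) (u k Γ j)
          + ε • (comm (uu k Γ i l) (uu k Γ j l)
          - uu k Γ i j ⊗ₜ[k] (uu k Γ i l - uu k Γ j l))) = 0) ∧
      (∀ i j l m, i ≠ j → i ≠ l → i ≠ m → j ≠ l → j ≠ m → l ≠ m →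
        TensorProduct.dualDistrib k _ _ f (comm (uu k Γ i j) (uu k Γ l m)) = 0) := by
  rw [QuadAlg.dualRel, Submodule.mem_comap, Submodule.mem_dualAnnihilator]
  change rel k Γ ε ≤ LinearMap.ker (TensorProduct.dualDistrib k _ _ f) ↔ _
  rw [rel, Submodule.span_le]
  rw [Set.union_subset_iff, Set.union_subset_iff]
  constructor
  · rintro ⟨⟨h1, h2⟩, h3⟩
    exact ⟨fun i j h => h1 ⟨i, j, h, rfl⟩, fun i j l h h' h'' => h2 ⟨i, j, l, h, h', h'', rfl⟩,
      fun i j l m a b c d e g => h3 ⟨i, j, l, m, a, b, c, d, e, g, rfl⟩⟩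
  · rintro ⟨h1, h2, h3⟩
    refine ⟨⟨?_, ?_⟩, ?_⟩
    · rintro _ ⟨i, j, h, rfl⟩
      exact h1 i j h
    · rintro _ ⟨i, j, l, h, h', h'', rfl⟩
      exact h2 i j l h h' h''
    · rintro _ ⟨i, j, l, m, a, b, c, d, e, g, rfl⟩
      exact h3 i j l m a b c d e g

/-- The relations between the generators of the quadratic dual. -/
structure IsDualSystem {E : Type*} [Ring E] [Algebra k E] (ε : k) (x : Fin n → E)
    (y : Γ.edgeSet → E) : Prop where
  vertex_sq : ∀ i, x i * x i = 0
  vertex_anti : ∀ i j, i ≠ j → x i * x j = -(x j * x i)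
  vertex_edge_zero : ∀ i (e : Γ.edgeSet), i ∈ e.1 → x i * y e = 0
  edge_vertex : ∀ i j (h : Γ.Adj i j), y ⟨s(i, j), h⟩ * x j = ε • (x i * x j)
  edge_vertex_anti : ∀ (e : Γ.edgeSet) i, i ∉ e.1 → y e * x i = -(x i * y e)
  edge_sq : ∀ e, y e * y e = 0
  edge_edge : ∀ i j l (h : Γ.Adj i j) (h' : Γ.Adj j l), i ≠ l →
    y ⟨s(i, j), h⟩ * y ⟨s(j, l), h'⟩ = ε • (x i * y ⟨s(j, l), h'⟩)
  edge_edge_anti : ∀ e f : Γ.edgeSet, (∀ v, v ∈ e.1 → v ∉ f.1) → y e * y f = -(y f * y e)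
  triangle : ∀ i j l, i < j → j < l → ∀ (h : Γ.Adj i j) (h' : Γ.Adj j l) (h'' : Γ.Adj i l),
    x i * y ⟨s(j, l), h'⟩ + x j * y ⟨s(i, l), h''⟩ + x l * y ⟨s(i, j), h⟩ = 0

/-- The generators of the quadratic dual: the dual basis. -/
noncomputable def dualGen (ε : k) (a : Fin n ⊕ Γ.edgeSet) :
    QuadAlg (QuadAlg.dualRel (rel k Γ ε)) :=
  QuadAlg.gen _ (Finsupp.lapply a)

open scoped Classical in
theorem lapply_inl_u (i j : Fin n) :
    (Finsupp.lapply (Sum.inl i) : Gens k Γ →ₗ[k] k) (u k Γ j) = if j = i then 1 else 0 := by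
  simp [u, Finsupp.single_apply]

theorem lapply_inl_uu (i j l : Fin n) :
    (Finsupp.lapply (Sum.inl i) : Gens k Γ →ₗ[k] k) (uu k Γ j l) = 0 := by
  unfold uu
  split_ifs <;> simp

theorem lapply_inr_u (e : Γ.edgeSet) (j : Fin n) :
    (Finsupp.lapply (Sum.inr e) : Gens k Γ →ₗ[k] k) (u k Γ j) = 0 := by
  simp [u]

open scoped Classical in
theorem lapply_inr_uu (e : Γ.edgeSet) (j l : Fin n) :
    (Finsupp.lapply (Sum.inr e) : Gens k Γ →ₗ[k] k) (uu k Γ j l) =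
      if s(j, l) = e.1 then 1 else 0 := by
  unfold uu
  split_ifs with h h' h'
  · rw [Finsupp.lapply_apply, Finsupp.single_apply, if_pos]
    exact congrArg Sum.inr (Subtype.ext h')
  · rw [Finsupp.lapply_apply, Finsupp.single_apply, if_neg]
    rintro h''
    exact h' (by simpa using congrArg Subtype.val (Sum.inr.inj h''))
  · exact absurd (h' ▸ e.2) h
  · simp

end GraphAlg

/-! ### The dual basis satisfies the dual relations. -/

set_option linter.unusedSimpArgs false

namespace GraphAlg

variable {k : Type*} [Field k] {n : ℕ} {Γ : SimpleGraph (Fin n)}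

/-- This and the next lemmas pair a candidate tensor with every generator of the relations. After
evaluation on basis vectors only the possible coincidences of indices remain, a finite case check.
-/
theorem vertex_sq_mem (ε : k) (i : Fin n) :
    (Finsupp.lapply (Sum.inl i) : Module.Dual k (Gens k Γ)) ⊗ₜ[k] (Finsupp.lapply (Sum.inl i) : Module.Dual k (Gens k Γ)) ∈
      QuadAlg.dualRel (rel k Γ ε) := by
  classical
  rw [mem_dualRel_rel]
  simp only [comm, map_sub, map_add, map_smul, TensorProduct.tmul_sub, LinearMap.sub_apply,
    LinearMap.smul_apply, LinearMap.add_apply, TensorProduct.dualDistrib_apply, lapply_inl_u,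
    lapply_inl_uu, lapply_inr_u, lapply_inr_uu, Sym2.eq_iff, smul_eq_mul, mul_zero, zero_mul,
    sub_zero, add_zero, zero_sub, zero_add]
  refine ⟨fun _ _ _ => ?_, fun _ _ _ _ _ _ => ?_, fun _ _ _ _ _ _ _ _ _ _ => ?_⟩ <;> grind

theorem vertex_anti_mem (ε : k) (i j : Fin n) :
    (Finsupp.lapply (Sum.inl i) : Module.Dual k (Gens k Γ)) ⊗ₜ[k] (Finsupp.lapply (Sum.inl j) : Module.Dual k (Gens k Γ)) +
      (Finsupp.lapply (Sum.inl j) : Module.Dual k (Gens k Γ)) ⊗ₜ[k] (Finsupp.lapply (Sum.inl i) : Module.Dual k (Gens k Γ)) ∈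
      QuadAlg.dualRel (rel k Γ ε) := by
  classical
  rw [mem_dualRel_rel]
  simp only [comm, map_sub, map_add, map_smul, TensorProduct.tmul_sub, LinearMap.sub_apply,
    LinearMap.smul_apply, LinearMap.add_apply, TensorProduct.dualDistrib_apply, lapply_inl_u,
    lapply_inl_uu, lapply_inr_u, lapply_inr_uu, Sym2.eq_iff, smul_eq_mul, mul_zero, zero_mul,
    sub_zero, add_zero, zero_sub, zero_add]
  refine ⟨fun _ _ _ => ?_, fun _ _ _ _ _ _ => ?_, fun _ _ _ _ _ _ _ _ _ _ => ?_⟩ <;> grind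

theorem vertex_edge_zero_mem (ε : k) (i j : Fin n) (h : Γ.Adj i j) :
    (Finsupp.lapply (Sum.inl i) : Module.Dual k (Gens k Γ)) ⊗ₜ[k] (Finsupp.lapply (Sum.inr ⟨s(i, j), h⟩) : Module.Dual k (Gens k Γ)) ∈
      QuadAlg.dualRel (rel k Γ ε) := by
  classical
  have hij := Γ.ne_of_adj h
  rw [mem_dualRel_rel]
  simp only [comm, map_sub, map_add, map_smul, TensorProduct.tmul_sub, LinearMap.sub_apply,
    LinearMap.smul_apply, LinearMap.add_apply, TensorProduct.dualDistrib_apply, lapply_inl_u,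
    lapply_inl_uu, lapply_inr_u, lapply_inr_uu, Sym2.eq_iff, smul_eq_mul, mul_zero, zero_mul,
    sub_zero, add_zero, zero_sub, zero_add]
  refine ⟨fun _ _ _ => ?_, fun _ _ _ _ _ _ => ?_, fun _ _ _ _ _ _ _ _ _ _ => ?_⟩ <;> grind

/-- In each relation the coefficient of u_ij ⊗ u_j is ε times that of u_i ⊗ u_j. -/
theorem edge_vertex_mem (ε : k) (i j : Fin n) (h : Γ.Adj i j) :
    (Finsupp.lapply (Sum.inr ⟨s(i, j), h⟩) : Module.Dual k (Gens k Γ)) ⊗ₜ[k] (Finsupp.lapply (Sum.inl j) : Module.Dual k (Gens k Γ)) -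
      ε • ((Finsupp.lapply (Sum.inl i) : Module.Dual k (Gens k Γ)) ⊗ₜ[k] (Finsupp.lapply (Sum.inl j) : Module.Dual k (Gens k Γ))) ∈
      QuadAlg.dualRel (rel k Γ ε) := by
  classical
  have hij := Γ.ne_of_adj h
  rw [mem_dualRel_rel]
  simp only [comm, map_sub, map_add, map_smul, TensorProduct.tmul_sub, LinearMap.sub_apply,
    LinearMap.smul_apply, LinearMap.add_apply, TensorProduct.dualDistrib_apply, lapply_inl_u,
    lapply_inl_uu, lapply_inr_u, lapply_inr_uu, Sym2.eq_iff, smul_eq_mul, mul_zero, zero_mul,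
    sub_zero, add_zero, zero_sub, zero_add]
  refine ⟨fun _ _ _ => ?_, fun _ _ _ _ _ _ => ?_, fun _ _ _ _ _ _ _ _ _ _ => ?_⟩ <;> grind

theorem edge_vertex_anti_mem (ε : k) (i j l : Fin n) (h : Γ.Adj i j) (hi : l ≠ i) (hj : l ≠ j) :
    (Finsupp.lapply (Sum.inr ⟨s(i, j), h⟩) : Module.Dual k (Gens k Γ)) ⊗ₜ[k] (Finsupp.lapply (Sum.inl l) : Module.Dual k (Gens k Γ)) +
      (Finsupp.lapply (Sum.inl l) : Module.Dual k (Gens k Γ)) ⊗ₜ[k] (Finsupp.lapply (Sum.inr ⟨s(i, j), h⟩) : Module.Dual k (Gens k Γ)) ∈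
      QuadAlg.dualRel (rel k Γ ε) := by
  classical
  have hij := Γ.ne_of_adj h
  rw [mem_dualRel_rel]
  simp only [comm, map_sub, map_add, map_smul, TensorProduct.tmul_sub, LinearMap.sub_apply,
    LinearMap.smul_apply, LinearMap.add_apply, TensorProduct.dualDistrib_apply, lapply_inl_u,
    lapply_inl_uu, lapply_inr_u, lapply_inr_uu, Sym2.eq_iff, smul_eq_mul, mul_zero, zero_mul,
    sub_zero, add_zero, zero_sub, zero_add]
  refine ⟨fun _ _ _ => ?_, fun _ _ _ _ _ _ => ?_, fun _ _ _ _ _ _ _ _ _ _ => ?_⟩ <;> grind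

theorem edge_sq_mem (ε : k) (i j : Fin n) (h : Γ.Adj i j) :
    (Finsupp.lapply (Sum.inr ⟨s(i, j), h⟩) : Module.Dual k (Gens k Γ)) ⊗ₜ[k] (Finsupp.lapply (Sum.inr ⟨s(i, j), h⟩) : Module.Dual k (Gens k Γ)) ∈
      QuadAlg.dualRel (rel k Γ ε) := by
  classical
  have hij := Γ.ne_of_adj h
  rw [mem_dualRel_rel]
  simp only [comm, map_sub, map_add, map_smul, TensorProduct.tmul_sub, LinearMap.sub_apply,
    LinearMap.smul_apply, LinearMap.add_apply, TensorProduct.dualDistrib_apply, lapply_inl_u,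
    lapply_inl_uu, lapply_inr_u, lapply_inr_uu, Sym2.eq_iff, smul_eq_mul, mul_zero, zero_mul,
    sub_zero, add_zero, zero_sub, zero_add]
  refine ⟨fun _ _ _ => ?_, fun _ _ _ _ _ _ => ?_, fun _ _ _ _ _ _ _ _ _ _ => ?_⟩ <;> grind

/-- In each relation the coefficient of u_ij ⊗ u_jl is ε times that of u_i ⊗ u_jl. -/
theorem edge_edge_mem (ε : k) (i j l : Fin n) (h : Γ.Adj i j) (h' : Γ.Adj j l) (hil : i ≠ l) :
    (Finsupp.lapply (Sum.inr ⟨s(i, j), h⟩) : Module.Dual k (Gens k Γ)) ⊗ₜ[k] (Finsupp.lapply (Sum.inr ⟨s(j, l), h'⟩) : Module.Dual k (Gens k Γ)) -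
      ε • ((Finsupp.lapply (Sum.inl i) : Module.Dual k (Gens k Γ)) ⊗ₜ[k] (Finsupp.lapply (Sum.inr ⟨s(j, l), h'⟩) : Module.Dual k (Gens k Γ))) ∈
      QuadAlg.dualRel (rel k Γ ε) := by
  classical
  have hij := Γ.ne_of_adj h
  have hjl := Γ.ne_of_adj h'
  rw [mem_dualRel_rel]
  simp only [comm, map_sub, map_add, map_smul, TensorProduct.tmul_sub, LinearMap.sub_apply,
    LinearMap.smul_apply, LinearMap.add_apply, TensorProduct.dualDistrib_apply, lapply_inl_u,
    lapply_inl_uu, lapply_inr_u, lapply_inr_uu, Sym2.eq_iff, smul_eq_mul, mul_zero, zero_mul,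
    sub_zero, add_zero, zero_sub, zero_add]
  refine ⟨fun _ _ _ => ?_, fun _ _ _ _ _ _ => ?_, fun _ _ _ _ _ _ _ _ _ _ => ?_⟩ <;> grind

theorem edge_edge_anti_mem (ε : k) (i j l m : Fin n) (h : Γ.Adj i j) (h' : Γ.Adj l m)
    (hil : i ≠ l) (him : i ≠ m) (hjl : j ≠ l) (hjm : j ≠ m) :
    (Finsupp.lapply (Sum.inr ⟨s(i, j), h⟩) : Module.Dual k (Gens k Γ)) ⊗ₜ[k] (Finsupp.lapply (Sum.inr ⟨s(l, m), h'⟩) : Module.Dual k (Gens k Γ)) +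
      (Finsupp.lapply (Sum.inr ⟨s(l, m), h'⟩) : Module.Dual k (Gens k Γ)) ⊗ₜ[k] (Finsupp.lapply (Sum.inr ⟨s(i, j), h⟩) : Module.Dual k (Gens k Γ)) ∈
      QuadAlg.dualRel (rel k Γ ε) := by
  classical
  have hij := Γ.ne_of_adj h
  have hlm := Γ.ne_of_adj h'
  rw [mem_dualRel_rel]
  simp only [comm, map_sub, map_add, map_smul, TensorProduct.tmul_sub, LinearMap.sub_apply,
    LinearMap.smul_apply, LinearMap.add_apply, TensorProduct.dualDistrib_apply, lapply_inl_u,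
    lapply_inl_uu, lapply_inr_u, lapply_inr_uu, Sym2.eq_iff, smul_eq_mul, mul_zero, zero_mul,
    sub_zero, add_zero, zero_sub, zero_add]
  refine ⟨fun _ _ _ => ?_, fun _ _ _ _ _ _ => ?_, fun _ _ _ _ _ _ _ _ _ _ => ?_⟩ <;> grind

/-- A relation involving these tensors contains exactly two of them, with coefficients 1 and -1. -/
theorem triangle_mem (ε : k) (i j l : Fin n) (h : Γ.Adj i j) (h' : Γ.Adj j l)
    (h'' : Γ.Adj i l) :
    (Finsupp.lapply (Sum.inl i) : Module.Dual k (Gens k Γ)) ⊗ₜ[k] (Finsupp.lapply (Sum.inr ⟨s(j, l), h'⟩) : Module.Dual k (Gens k Γ)) +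
      (Finsupp.lapply (Sum.inl j) : Module.Dual k (Gens k Γ)) ⊗ₜ[k] (Finsupp.lapply (Sum.inr ⟨s(i, l), h''⟩) : Module.Dual k (Gens k Γ)) +
      (Finsupp.lapply (Sum.inl l) : Module.Dual k (Gens k Γ)) ⊗ₜ[k] (Finsupp.lapply (Sum.inr ⟨s(i, j), h⟩) : Module.Dual k (Gens k Γ)) ∈
      QuadAlg.dualRel (rel k Γ ε) := by
  classical
  have hij := Γ.ne_of_adj h
  have hjl := Γ.ne_of_adj h'
  have hil := Γ.ne_of_adj h''
  rw [mem_dualRel_rel]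
  simp only [comm, map_sub, map_add, map_smul, TensorProduct.tmul_sub, LinearMap.sub_apply,
    LinearMap.smul_apply, LinearMap.add_apply, TensorProduct.dualDistrib_apply, lapply_inl_u,
    lapply_inl_uu, lapply_inr_u, lapply_inr_uu, Sym2.eq_iff, smul_eq_mul, mul_zero, zero_mul,
    sub_zero, add_zero, zero_sub, zero_add]
  refine ⟨fun _ _ _ => ?_, fun _ _ _ _ _ _ => ?_, fun _ _ _ _ _ _ _ _ _ _ => ?_⟩ <;> grind

theorem isDualSystem_dualGen (ε : k) :
    IsDualSystem (Γ := Γ) ε (fun i => dualGen ε (Sum.inl i)) (fun e => dualGen ε (Sum.inr e)) := by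
  have key := fun r => QuadAlg.mulMap_gen (QuadAlg.dualRel (rel k Γ ε)) (r := r)
  constructor
  · intro i
    have := key _ (vertex_sq_mem ε i)
    rwa [QuadAlg.mulMap_tmul] at this
  · intro i j h
    have := key _ (vertex_anti_mem ε i j)
    rw [map_add, QuadAlg.mulMap_tmul, QuadAlg.mulMap_tmul] at this
    exact eq_neg_of_add_eq_zero_left this
  · rintro i ⟨e, he⟩ hi
    obtain ⟨j, rfl⟩ := Sym2.mem_iff_exists.mp hi
    have := key _ (vertex_edge_zero_mem ε i j he)
    rwa [QuadAlg.mulMap_tmul] at this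
  · intro i j h
    have := key _ (edge_vertex_mem ε i j h)
    rw [map_sub, map_smul, QuadAlg.mulMap_tmul, QuadAlg.mulMap_tmul] at this
    exact sub_eq_zero.mp this
  · rintro ⟨⟨i, j⟩, h⟩ l hl
    have hl' := not_or.mp (mt Sym2.mem_iff.mpr hl)
    have := key _ (edge_vertex_anti_mem ε i j l h hl'.1 hl'.2)
    rw [map_add, QuadAlg.mulMap_tmul, QuadAlg.mulMap_tmul] at this
    exact eq_neg_of_add_eq_zero_left this
  · rintro ⟨⟨i, j⟩, h⟩
    have := key _ (edge_sq_mem ε i j h)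
    rwa [QuadAlg.mulMap_tmul] at this
  · intro i j l h h' hil
    have := key _ (edge_edge_mem ε i j l h h' hil)
    rw [map_sub, map_smul, QuadAlg.mulMap_tmul, QuadAlg.mulMap_tmul] at this
    exact sub_eq_zero.mp this
  · rintro ⟨⟨i, j⟩, h⟩ ⟨⟨l, m⟩, h'⟩ hd
    have hi := not_or.mp (mt Sym2.mem_iff.mpr (hd i (Sym2.mem_mk_left i j)))
    have hj := not_or.mp (mt Sym2.mem_iff.mpr (hd j (Sym2.mem_mk_right i j)))
    have := key _ (edge_edge_anti_mem ε i j l m h h' hi.1 hi.2 hj.1 hj.2)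
    rw [map_add, QuadAlg.mulMap_tmul, QuadAlg.mulMap_tmul] at this
    exact eq_neg_of_add_eq_zero_left this
  · intro i j l _ _ h h' h''
    have := key _ (triangle_mem ε i j l h h' h'')
    rwa [map_add, map_add, QuadAlg.mulMap_tmul, QuadAlg.mulMap_tmul,
      QuadAlg.mulMap_tmul] at this

end GraphAlg

/-! ### Rearrangement of finite sums over vertices and edges. -/

namespace GraphAlg

section Sums

variable {E α : Type*} [AddCommGroup E] [Fintype α]

/-- Terms cancel in pairs under the swap. The diagonal needs its own hypothesis, because
antisymmetry alone only gives 2 w(p,p) = 0, which is empty in characteristic two. -/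
theorem sum_antisymm_eq_zero (w : α → α → E) (h0 : ∀ p, w p p = 0)
    (h : ∀ p q, w p q + w q p = 0) : ∑ p, ∑ q, w p q = 0 := by
  rw [← Fintype.sum_prod_type' (f := w)]
  refine Finset.sum_involution (fun a _ => a.swap) (fun a _ => h a.1 a.2) ?_
    (fun _ _ => Finset.mem_univ _) (fun _ _ => rfl)
  rintro ⟨p, q⟩ _ hne heq
  obtain rfl : q = p := congrArg Prod.fst heq
  exact hne (h0 q)

variable [LinearOrder α]

theorem sum_lt_symm (v : α → α → E) :
    (∑ i, ∑ j, if j < i then v i j + v j i else 0) = ∑ i, ∑ j, if i ≠ j then v i j else 0 := by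
  have h1 : (∑ i, ∑ j, if j < i then v j i else 0) = ∑ i, ∑ j, if i < j then v i j else 0 :=
    Finset.sum_comm
  calc (∑ i, ∑ j, if j < i then v i j + v j i else 0)
      = (∑ i, ∑ j, if j < i then v i j else 0) + ∑ i, ∑ j, if j < i then v j i else 0 := by
        simp_rw [← Finset.sum_add_distrib]
        refine Finset.sum_congr rfl fun i _ => Finset.sum_congr rfl fun j _ => ?_
        split_ifs <;> simp
    _ = _ := by
        rw [h1]
        simp_rw [← Finset.sum_add_distrib]
        refine Finset.sum_congr rfl fun i _ => Finset.sum_congr rfl fun j _ => ?_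
        rcases lt_trichotomy i j with h | h | h
        · simp [h, h.not_gt, h.ne]
        · simp [h]
        · simp [h, h.not_gt, h.ne']

/-- A vertex i together with a pair c < b avoiding it is an increasing triple with one marked
element. Splitting by the position of i groups the sum by increasing triples, each contributing its
three markings. -/
theorem sum_triples_eq_zero (H : α → α → α → E)
    (h : ∀ p q r, p < q → q < r → H p r q + H q r p + H r q p = 0) :
    (∑ i, ∑ b, ∑ c, if c < b ∧ i ≠ b ∧ i ≠ c then H i b c else 0) = 0 := by
  have h1 : (∑ i, ∑ b, ∑ c, if c < b ∧ i ≠ b ∧ i ≠ c then H i b c else 0) =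
      (∑ i, ∑ b, ∑ c, if i < c ∧ c < b then H i b c else 0) +
      (∑ i, ∑ b, ∑ c, if c < i ∧ i < b then H i b c else 0) +
      (∑ i, ∑ b, ∑ c, if c < b ∧ b < i then H i b c else 0) := by
    simp_rw [← Finset.sum_add_distrib]
    refine Finset.sum_congr rfl fun i _ => Finset.sum_congr rfl fun b _ =>
      Finset.sum_congr rfl fun c _ => ?_
    rcases lt_trichotomy c b with h | h | h
    · rcases lt_trichotomy i c with h' | h' | h'
      · simp [h, h', h'.ne, (h'.trans h).ne, h'.not_gt, (h'.trans h).not_gt]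
      · simp [h, h', h.not_gt]
      · rcases lt_trichotomy i b with h'' | h'' | h''
        · simp [h, h', h'.ne', h'.not_gt, h'', h''.ne, h''.not_gt]
        · simp [h'', h.not_gt]
        · simp [h, h', h'.ne', h'.not_gt, h'', h''.ne', h''.not_gt]
    · subst h
      simp only [lt_self_iff_false, false_and, and_false, if_false, zero_add, add_zero]
      rw [if_neg]
      exact fun h => h.1.not_gt h.2
    · rw [if_neg fun h' => h'.1.not_gt h, if_neg fun h' => h'.2.not_gt h,
        if_neg fun h' => (h'.1.trans h'.2).not_gt h, if_neg fun h' => h'.1.not_gt h]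
      simp
  have h2 : (∑ i, ∑ b, ∑ c, if i < c ∧ c < b then H i b c else 0) =
      ∑ p, ∑ q, ∑ r, if p < q ∧ q < r then H p r q else 0 :=
    Finset.sum_congr rfl fun p _ => Finset.sum_comm
  have h3 : (∑ i, ∑ b, ∑ c, if c < i ∧ i < b then H i b c else 0) =
      ∑ p, ∑ q, ∑ r, if p < q ∧ q < r then H q r p else 0 := by
    rw [Finset.sum_comm' (t' := Finset.univ) (s' := fun _ => Finset.univ) (by simp)]
    rw [Finset.sum_congr rfl fun b _ => Finset.sum_comm, Finset.sum_comm]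
    exact Finset.sum_congr rfl fun b _ => Finset.sum_comm
  have h4 : (∑ i, ∑ b, ∑ c, if c < b ∧ b < i then H i b c else 0) =
      ∑ p, ∑ q, ∑ r, if p < q ∧ q < r then H r q p else 0 := by
    rw [Finset.sum_congr rfl fun b _ => Finset.sum_comm, Finset.sum_comm]
    exact Finset.sum_congr rfl fun b _ => Finset.sum_comm
  rw [h1, h2, h3, h4]
  simp_rw [← Finset.sum_add_distrib]
  refine Finset.sum_eq_zero fun p _ => Finset.sum_eq_zero fun q _ =>
    Finset.sum_eq_zero fun r _ => ?_
  split_ifs with h'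
  · exact h p q r h'.1 h'.2
  · simp

/-- Each edge has exactly one representative with the larger endpoint first; the convention j < i is
used in all later sums over edges. -/
theorem sum_edgeSet {n : ℕ} {Γ : SimpleGraph (Fin n)} [Fintype Γ.edgeSet] (h : Γ.edgeSet → E)
    (H : Fin n → Fin n → E) (h1 : ∀ i j (hij : Γ.Adj i j), H i j = h ⟨s(i, j), hij⟩)
    (h0 : ∀ i j, ¬ Γ.Adj i j → H i j = 0) :
    ∑ e, h e = ∑ i, ∑ j, if j < i then H i j else 0 := by
  classical
  rw [← Fintype.sum_prod_type' (f := fun i j => if j < i then H i j else 0)]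
  have h2 : (∑ p : Fin n × Fin n, if p.2 < p.1 then H p.1 p.2 else 0) =
      ∑ p ∈ Finset.univ.filter (fun p : Fin n × Fin n => p.2 < p.1 ∧ Γ.Adj p.1 p.2),
        H p.1 p.2 := by
    rw [Finset.sum_filter]
    refine Finset.sum_congr rfl fun p _ => ?_
    by_cases ha : Γ.Adj p.1 p.2
    · simp [ha]
    · simp [ha, h0 _ _ ha]
  rw [h2, Finset.sum_subtype (p := fun p : Fin n × Fin n => p.2 < p.1 ∧ Γ.Adj p.1 p.2) _ (by simp)]
  symm
  refine Fintype.sum_bijective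
    (fun p : {p : Fin n × Fin n // p.2 < p.1 ∧ Γ.Adj p.1 p.2} =>
      (⟨s(p.1.1, p.1.2), p.2.2⟩ : Γ.edgeSet)) ⟨?_, ?_⟩ _ _ fun p => h1 _ _ p.2.2
  · rintro ⟨⟨a, b⟩, hab, h'⟩ ⟨⟨c, d⟩, hcd, h''⟩ heq
    have := congrArg Subtype.val heq
    simp only [Sym2.eq_iff] at this
    rcases this with ⟨rfl, rfl⟩ | ⟨rfl, rfl⟩
    · rfl
    · exact absurd hab hcd.not_gt
  · rintro ⟨⟨a, b⟩, hab⟩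
    rcases lt_or_gt_of_ne (Γ.ne_of_adj hab) with h' | h'
    · exact ⟨⟨(b, a), h', Γ.adj_symm hab⟩, Subtype.ext Sym2.eq_swap⟩
    · exact ⟨⟨(a, b), h', hab⟩, rfl⟩

end Sums
end GraphAlg

/-! ### The dual relations imply every relation in R^⊥. -/

namespace GraphAlg

variable {k : Type*} [Field k] {n : ℕ} {Γ : SimpleGraph (Fin n)}
variable {E : Type*} [Ring E] [Algebra k E]

open scoped Classical in
/-- The extension by zero of a family indexed by edges to all pairs of vertices. -/
noncomputable def extendEdge (y : Γ.edgeSet → E) (i j : Fin n) : E :=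
  if h : Γ.Adj i j then y ⟨s(i, j), h⟩ else 0

theorem extendEdge_of_adj (y : Γ.edgeSet → E) {i j : Fin n} (h : Γ.Adj i j) :
    extendEdge y i j = y ⟨s(i, j), h⟩ := dif_pos h

theorem extendEdge_of_not_adj (y : Γ.edgeSet → E) {i j : Fin n} (h : ¬ Γ.Adj i j) :
    extendEdge y i j = 0 := dif_neg h

theorem extendEdge_symm (y : Γ.edgeSet → E) (i j : Fin n) :
    extendEdge y i j = extendEdge y j i := by
  by_cases h : Γ.Adj i j
  · rw [extendEdge_of_adj y h, extendEdge_of_adj y h.symm]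
    congr 2
    exact Sym2.eq_swap
  · rw [extendEdge_of_not_adj y h, extendEdge_of_not_adj y fun h' => h h'.symm]

namespace IsDualSystem

variable {ε : k} {x : Fin n → E} {y : Γ.edgeSet → E} (S : IsDualSystem ε x y)
include S

theorem edge_vertex_anti' {i j v : Fin n} (hi : v ≠ i) (hj : v ≠ j) :
    extendEdge y i j * x v = -(x v * extendEdge y i j) := by
  by_cases h : Γ.Adj i j
  · rw [extendEdge_of_adj y h]
    exact S.edge_vertex_anti _ _ (by simp [hi, hj])
  · simp [extendEdge_of_not_adj y h]

theorem edge_vertex' {i j : Fin n} (h : Γ.Adj i j) :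
    extendEdge y i j * x j = ε • (x i * x j) := by
  rw [extendEdge_of_adj y h]
  exact S.edge_vertex _ _ _

theorem vertex_edge_zero' (i j : Fin n) : x i * extendEdge y i j = 0 := by
  by_cases h : Γ.Adj i j
  · rw [extendEdge_of_adj y h]
    exact S.vertex_edge_zero _ _ (by simp)
  · simp [extendEdge_of_not_adj y h]

theorem edge_sq' (i j : Fin n) : extendEdge y i j * extendEdge y i j = 0 := by
  by_cases h : Γ.Adj i j
  · rw [extendEdge_of_adj y h]
    exact S.edge_sq _
  · simp [extendEdge_of_not_adj y h]

theorem edge_edge' {i j l : Fin n} (h : Γ.Adj i j) (hil : i ≠ l) :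
    extendEdge y i j * extendEdge y j l = ε • (x i * extendEdge y j l) := by
  by_cases h' : Γ.Adj j l
  · rw [extendEdge_of_adj y h, extendEdge_of_adj y h']
    exact S.edge_edge _ _ _ _ _ hil
  · simp [extendEdge_of_not_adj y h']

theorem edge_edge_anti' {i j l m : Fin n} (hil : i ≠ l) (him : i ≠ m) (hjl : j ≠ l)
    (hjm : j ≠ m) :
    extendEdge y i j * extendEdge y l m = -(extendEdge y l m * extendEdge y i j) := by
  by_cases h : Γ.Adj i j
  · by_cases h' : Γ.Adj l m
    · rw [extendEdge_of_adj y h, extendEdge_of_adj y h']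
      refine S.edge_edge_anti _ _ fun v hv hv' => ?_
      rcases Sym2.mem_iff.mp hv with rfl | rfl <;> rcases Sym2.mem_iff.mp hv' with h | h <;>
        contradiction
    · simp [extendEdge_of_not_adj y h']
  · simp [extendEdge_of_not_adj y h]

theorem triangle' {i j l : Fin n} (hij : i < j) (hjl : j < l) (h : Γ.Adj i j) (h' : Γ.Adj j l) (h'' : Γ.Adj i l) :
    x i * extendEdge y j l + x j * extendEdge y i l + x l * extendEdge y i j = 0 := by
  rw [extendEdge_of_adj y h, extendEdge_of_adj y h', extendEdge_of_adj y h'']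
  exact S.triangle _ _ _ hij hjl _ _ _

/-- Normal ordering of the products y x. A vertex on the edge turns the product into ε x x, and the
two endpoints of an edge together give both orders of the pair; any other vertex anticommutes past
the edge. -/
theorem sum_edge_mul_vertex (Fr : Fin n → Fin n → Fin n → k)
    (hr0 : ∀ b c i, ¬ Γ.Adj b c → Fr b c i = 0) (hrs : ∀ b c i, Fr b c i = Fr c b i) :
    (∑ b, ∑ c, if c < b then ∑ i, Fr b c i • (extendEdge y b c * x i) else 0) =
        (∑ b, ∑ c, if b ≠ c then (ε * Fr b c c) • (x b * x c) else 0) -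
        ∑ i, ∑ b, ∑ c, if c < b ∧ i ≠ b ∧ i ≠ c then Fr b c i • (x i * extendEdge y b c) else 0 := by
  set Y := extendEdge y with hY
  have e1 : (∑ i, ∑ b, ∑ c, if c < b ∧ i ≠ b ∧ i ≠ c then Fr b c i • (x i * Y b c) else 0) =
      ∑ b, ∑ c, if c < b then
        ∑ i, (if i ≠ b ∧ i ≠ c then Fr b c i • (x i * Y b c) else 0) else 0 := by
    rw [Finset.sum_comm]
    refine Finset.sum_congr rfl fun b _ => ?_
    rw [Finset.sum_comm]
    refine Finset.sum_congr rfl fun c _ => ?_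
    split_ifs with h <;> simp [h]
  rw [e1, ← sum_lt_symm]
  simp_rw [← Finset.sum_sub_distrib]
  refine Finset.sum_congr rfl fun b _ => Finset.sum_congr rfl fun c _ => ?_
  split_ifs with hcb
  · by_cases ha : Γ.Adj b c
    · have e2 : ∀ i, Fr b c i • (Y b c * x i) =
          (if i = c then (ε * Fr b c c) • (x b * x c) else 0) +
          (if i = b then (ε * Fr c b b) • (x c * x b) else 0) -
          (if i ≠ b ∧ i ≠ c then Fr b c i • (x i * Y b c) else 0) := by
        intro i
        by_cases hc : i = c
        · subst hc
          rw [S.edge_vertex' ha]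
          simp [hcb.ne, smul_smul, mul_comm]
        · by_cases hb : i = b
          · subst hb
            rw [hY, extendEdge_symm, ← hY, S.edge_vertex' ha.symm]
            simp [hcb.ne', smul_smul, mul_comm, hrs i c]
          · rw [S.edge_vertex_anti' hb hc]
            simp [hb, hc, hY]
      rw [Finset.sum_congr rfl fun i _ => e2 i, Finset.sum_sub_distrib,
        Finset.sum_add_distrib, Finset.sum_ite_eq' Finset.univ c,
        Finset.sum_ite_eq' Finset.univ b]
      simp
    · have ha' : ¬ Γ.Adj c b := fun h => ha h.symm
      simp [hr0 _ _ _ ha, hr0 _ _ _ ha']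
  · simp

/-- Normal ordering of the products y y. Equal edges give zero; disjoint edges cancel, since they
anticommute while their coefficients are symmetric; edges with one common vertex give ε x y. -/
theorem sum_edge_mul_edge (Fe : Fin n → Fin n → Fin n → Fin n → k)
    (he0 : ∀ i j b c, ¬ Γ.Adj i j → Fe i j b c = 0)
    (hes : ∀ i j b c, Fe i j b c = Fe j i b c)
    (h3 : ∀ i j l m, i ≠ j → i ≠ l → i ≠ m → j ≠ l → j ≠ m → l ≠ m →
      Fe i j l m = Fe l m i j) :
    (∑ b, ∑ c, if c < b then ∑ i, ∑ j, (if j < i then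
          Fe i j b c • (extendEdge y i j * extendEdge y b c) else 0) else 0) =
        ∑ i, ∑ b, ∑ c, if c < b ∧ i ≠ b ∧ i ≠ c then
          (ε * (Fe i b b c + Fe i c b c)) • (x i * extendEdge y b c) else 0 := by
  set Y := extendEdge y with hY
  have hw : (∑ b, ∑ c, if c < b then ∑ i, ∑ j, (if j < i ∧ i ≠ b ∧ i ≠ c ∧ j ≠ b ∧ j ≠ c then
      Fe i j b c • (Y i j * Y b c) else 0) else 0) = 0 := by
    have := sum_antisymm_eq_zero (fun p q : Fin n × Fin n =>
      if p.2 < p.1 ∧ q.2 < q.1 ∧ q.1 ≠ p.1 ∧ q.1 ≠ p.2 ∧ q.2 ≠ p.1 ∧ q.2 ≠ p.2 then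
        Fe q.1 q.2 p.1 p.2 • (Y q.1 q.2 * Y p.1 p.2) else 0) (by simp) (by
      intro p q
      by_cases h : p.2 < p.1 ∧ q.2 < q.1 ∧ q.1 ≠ p.1 ∧ q.1 ≠ p.2 ∧ q.2 ≠ p.1 ∧ q.2 ≠ p.2
      · have h' : q.2 < q.1 ∧ p.2 < p.1 ∧ p.1 ≠ q.1 ∧ p.1 ≠ q.2 ∧ p.2 ≠ q.1 ∧ p.2 ≠ q.2 := by
          tauto
        rw [if_pos h, if_pos h', S.edge_edge_anti' h.2.2.1 h.2.2.2.1 h.2.2.2.2.1 h.2.2.2.2.2,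
          h3 _ _ _ _ h.2.1.ne' h.2.2.1 h.2.2.2.1 h.2.2.2.2.1 h.2.2.2.2.2 h.1.ne']
        simp [hY]
      · have h' : ¬ (q.2 < q.1 ∧ p.2 < p.1 ∧ p.1 ≠ q.1 ∧ p.1 ≠ q.2 ∧ p.2 ≠ q.1 ∧
          p.2 ≠ q.2) := by tauto
        rw [if_neg h, if_neg h', add_zero])
    rw [Fintype.sum_prod_type] at this
    refine Eq.trans ?_ this
    refine Finset.sum_congr rfl fun b _ => Finset.sum_congr rfl fun c _ => ?_
    rw [Fintype.sum_prod_type]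
    split_ifs with h <;> simp [h]
  have e1 : (∑ i, ∑ b, ∑ c, if c < b ∧ i ≠ b ∧ i ≠ c then
        (ε * (Fe i b b c + Fe i c b c)) • (x i * Y b c) else 0) =
      ∑ b, ∑ c, if c < b then ∑ i, (if i ≠ b ∧ i ≠ c then
        (ε * (Fe i b b c + Fe i c b c)) • (x i * Y b c) else 0) else 0 := by
    rw [Finset.sum_comm]
    refine Finset.sum_congr rfl fun b _ => ?_
    rw [Finset.sum_comm]
    refine Finset.sum_congr rfl fun c _ => ?_
    split_ifs with h <;> simp [h]
  refine Eq.trans ?_ (e1.trans (add_zero _).symm).symm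
  refine Eq.trans ?_ (congrArg (_ + ·) hw)
  simp_rw [← Finset.sum_add_distrib]
  refine Finset.sum_congr rfl fun b _ => Finset.sum_congr rfl fun c _ => ?_
  split_ifs with hcb
  swap
  · simp
  -- The contribution of the edge ij when it meets bc exactly in j. Summing over unordered pairs,
  -- `sum_lt_symm` accounts for either endpoint being the common one.
  let v : Fin n → Fin n → E := fun i j => if i ≠ b ∧ i ≠ c ∧ (j = b ∨ j = c) then
    (ε * Fe i j b c) • (x i * Y b c) else 0
  have e3 : (∑ i, (if i ≠ b ∧ i ≠ c then
      (ε * (Fe i b b c + Fe i c b c)) • (x i * Y b c) else 0)) =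
      ∑ i, ∑ j, if i ≠ j then v i j else 0 := by
    refine Finset.sum_congr rfl fun i _ => ?_
    by_cases hi : i ≠ b ∧ i ≠ c
    · have e4 : ∀ j, (if i ≠ j then v i j else 0) =
          (if j = b then (ε * Fe i b b c) • (x i * Y b c) else 0) +
          (if j = c then (ε * Fe i c b c) • (x i * Y b c) else 0) := by
        intro j
        by_cases hjb : j = b
        · subst hjb
          simp [v, hi, hcb.ne']
        · by_cases hjc : j = c
          · subst hjc
            simp [v, hi, hcb.ne]
          · simp [v, hjb, hjc]
      rw [if_pos hi, Finset.sum_congr rfl fun j _ => e4 j, Finset.sum_add_distrib,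
        Finset.sum_ite_eq' Finset.univ c, Finset.sum_ite_eq' Finset.univ b]
      simp [mul_add, add_smul]
    · rw [if_neg hi, Finset.sum_eq_zero]
      intro j _
      have : v i j = 0 := if_neg fun h => hi ⟨h.1, h.2.1⟩
      simp [this]
  rw [e3, ← sum_lt_symm]
  simp_rw [← Finset.sum_add_distrib]
  refine Finset.sum_congr rfl fun i _ => Finset.sum_congr rfl fun j _ => ?_
  by_cases hji : j < i
  swap
  · simp [hji]
  rw [if_pos hji, if_pos hji]
  have hmeet : ∀ i j, i ≠ b → i ≠ c → (j = b ∨ j = c) →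
      Fe i j b c • (Y i j * Y b c) = (ε * Fe i j b c) • (x i * Y b c) := by
    intro i j hib hic hj
    by_cases ha : Γ.Adj i j
    · rcases hj with rfl | rfl
      · rw [S.edge_edge' ha hic, smul_smul, mul_comm]
      · rw [hY, extendEdge_symm y b, S.edge_edge' ha hib, smul_smul, mul_comm]
    · simp [he0 _ _ _ _ ha]
  by_cases hi : i = b ∨ i = c
  · by_cases hj : j = b ∨ j = c
    · have : i = b ∧ j = c := by
        rcases hi with rfl | rfl <;> rcases hj with rfl | rfl
        · exact absurd hji (lt_irrefl _)
        · exact ⟨rfl, rfl⟩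
        · exact absurd hji hcb.not_gt
        · exact absurd hji (lt_irrefl _)
      obtain ⟨rfl, rfl⟩ := this
      rw [S.edge_sq']
      simp [v]
    · have hj' := not_or.mp hj
      have e5 : Y i j = Y j i := extendEdge_symm y i j
      rw [hes i j, e5, hmeet j i hj'.1 hj'.2 hi]
      have hi' : ¬ (i ≠ b ∧ i ≠ c) := by tauto
      simp only [v]
      rw [if_neg (by tauto), if_pos (by tauto), if_neg (by tauto)]
      simp
  · have hi' := not_or.mp hi
    by_cases hj : j = b ∨ j = c
    · rw [hmeet i j hi'.1 hi'.2 hj]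
      simp only [v]
      rw [if_pos (by tauto), if_neg (by tauto), if_neg (by tauto)]
      simp
    · simp only [v]
      rw [if_neg (by tauto), if_neg (by tauto), if_pos (by tauto)]
      simp

/-- A quadratic expression in the generators vanishes if its coefficients satisfy the relations
of the dual algebra. -/
theorem quadratic_eq_zero (Fv : Fin n → Fin n → k) (Fl Fr : Fin n → Fin n → Fin n → k)
    (Fe : Fin n → Fin n → Fin n → Fin n → k)
    (hl0 : ∀ i b c, ¬ Γ.Adj b c → Fl i b c = 0) (hls : ∀ i b c, Fl i b c = Fl i c b)
    (hr0 : ∀ b c i, ¬ Γ.Adj b c → Fr b c i = 0) (hrs : ∀ b c i, Fr b c i = Fr c b i)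
    (he0 : ∀ i j b c, ¬ Γ.Adj i j → Fe i j b c = 0)
    (he0' : ∀ i j b c, ¬ Γ.Adj b c → Fe i j b c = 0)
    (hes : ∀ i j b c, Fe i j b c = Fe j i b c)
    (hes' : ∀ i j b c, Fe i j b c = Fe i j c b)
    (h1 : ∀ i j, i ≠ j → Fv i j - Fv j i = ε * (Fr i j i - Fr i j j))
    (h2 : ∀ i j l, i ≠ j → i ≠ l → j ≠ l →
      Fl i j l - Fr j l i + ε * (Fe i j j l + Fe i l j l) =
      Fl j i l - Fr i l j + ε * (Fe j i i l + Fe j l i l))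
    (h3 : ∀ i j l m, i ≠ j → i ≠ l → i ≠ m → j ≠ l → j ≠ m → l ≠ m →
      Fe i j l m = Fe l m i j) :
    (∑ i, ∑ j, Fv i j • (x i * x j)) +
    (∑ i, ∑ b, ∑ c, if c < b then Fl i b c • (x i * extendEdge y b c) else 0) +
    (∑ b, ∑ c, if c < b then ∑ i, Fr b c i • (extendEdge y b c * x i) else 0) +
    (∑ b, ∑ c, if c < b then ∑ i, ∑ j, (if j < i then
      Fe i j b c • (extendEdge y i j * extendEdge y b c) else 0) else 0) = 0 := by
  have hR := S.sum_edge_mul_vertex Fr hr0 hrs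
  have hE := S.sum_edge_mul_edge Fe he0 hes h3
  set Y := extendEdge y with hY
  -- the products `x x`
  have hV : (∑ i, ∑ j, Fv i j • (x i * x j)) +
      (∑ b, ∑ c, if b ≠ c then (ε * Fr b c c) • (x b * x c) else 0) = 0 := by
    simp_rw [← Finset.sum_add_distrib]
    refine sum_antisymm_eq_zero _ (fun p => by simp [S.vertex_sq]) fun p q => ?_
    by_cases hpq : p = q
    · subst hpq
      simp [S.vertex_sq]
    · rw [if_pos hpq, if_pos (Ne.symm hpq), S.vertex_anti q p (Ne.symm hpq), hrs q p,
        ← add_smul, ← add_smul, smul_neg, ← sub_eq_add_neg, ← sub_smul]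
      have : Fv p q + ε * Fr p q q - (Fv q p + ε * Fr p q p) = 0 := by
        linear_combination h1 p q hpq
      rw [this, zero_smul]
  have hL : (∑ i, ∑ b, ∑ c, if c < b then Fl i b c • (x i * Y b c) else 0) =
      ∑ i, ∑ b, ∑ c, if c < b ∧ i ≠ b ∧ i ≠ c then Fl i b c • (x i * Y b c) else 0 := by
    refine Finset.sum_congr rfl fun i _ => Finset.sum_congr rfl fun b _ =>
      Finset.sum_congr rfl fun c _ => ?_
    by_cases hb : i = b
    · subst hb
      rw [S.vertex_edge_zero']
      simp
    · by_cases hc : i = c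
      · subst hc
        rw [hY, extendEdge_symm, S.vertex_edge_zero']
        simp
      · simp [hb, hc]
  -- The total coefficient of x_i y_bc after normal ordering. It is symmetric in b, c, and `h2`
  -- exchanges i with b, so it is fully symmetric on distinct triples. If some edge of the triple is
  -- missing it vanishes; otherwise it multiplies the triangle relation.
  let G : Fin n → Fin n → Fin n → k := fun i b c =>
    Fl i b c - Fr b c i + ε * (Fe i b b c + Fe i c b c)
  have hG : (∑ i, ∑ b, ∑ c, if c < b ∧ i ≠ b ∧ i ≠ c then G i b c • (x i * Y b c) else 0) = 0 := by
    refine sum_triples_eq_zero _ fun p q r hpq hqr => ?_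
    have hpr := hpq.trans hqr
    have hGs : ∀ i b c, G i b c = G i c b := by
      intro i b c
      simp only [G]
      rw [hls i b, hrs b, hes' _ _ b, hes' _ _ b c]
      ring
    have hG0 : ∀ i b c, ¬ Γ.Adj b c → G i b c = 0 := by
      intro i b c h
      simp [G, hl0 _ _ _ h, hr0 _ _ _ h, he0' _ _ _ _ h]
    have g1 : G p q r = G q p r := h2 p q r hpq.ne hpr.ne hqr.ne
    have g2 : G p r q = G r p q := h2 p r q hpr.ne hpq.ne hqr.ne'
    have g3 : G q r p = G p q r := by rw [hGs, g1]
    have g4 : G r q p = G p q r := by rw [hGs r, ← g2, hGs]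
    rw [hGs p, g3, g4, ← smul_add, ← smul_add]
    by_cases a1 : Γ.Adj q r
    · by_cases a2 : Γ.Adj p r
      · by_cases a3 : Γ.Adj p q
        · have := S.triangle' hpq hqr a3 a1 a2
          rw [extendEdge_symm y q r, extendEdge_symm y p r, extendEdge_symm y p q] at this
          rw [hY, this, smul_zero]
        · rw [← g4, hG0 r q p fun h => a3 h.symm, zero_smul]
      · rw [← g3, hG0 q r p fun h => a2 h.symm, zero_smul]
    · rw [hG0 _ _ _ a1, zero_smul]
  rw [hL, hR, hE]
  calc _ = ((∑ i, ∑ j, Fv i j • (x i * x j)) +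
      (∑ b, ∑ c, if b ≠ c then (ε * Fr b c c) • (x b * x c) else 0)) +
      ((∑ i, ∑ b, ∑ c, if c < b ∧ i ≠ b ∧ i ≠ c then Fl i b c • (x i * Y b c) else 0) -
      (∑ i, ∑ b, ∑ c, if c < b ∧ i ≠ b ∧ i ≠ c then Fr b c i • (x i * Y b c) else 0) +
      ∑ i, ∑ b, ∑ c, if c < b ∧ i ≠ b ∧ i ≠ c then
        (ε * (Fe i b b c + Fe i c b c)) • (x i * Y b c) else 0) := by abel
    _ = 0 := by
      rw [hV, zero_add]
      refine Eq.trans ?_ hG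
      simp_rw [← Finset.sum_sub_distrib, ← Finset.sum_add_distrib]
      refine Finset.sum_congr rfl fun i _ => Finset.sum_congr rfl fun b _ =>
        Finset.sum_congr rfl fun c _ => ?_
      split_ifs
      · simp only [G, add_smul, sub_smul]
      · simp

end IsDualSystem
end GraphAlg

/-! ### Homomorphisms out of the dual algebra. -/

namespace GraphAlg

variable {k : Type*} [Field k] {n : ℕ} {Γ : SimpleGraph (Fin n)}
variable {E : Type*} [Ring E] [Algebra k E]

/-- The linear map on the dual space taking given values on the dual basis. -/
noncomputable def dualMap {ι : Type*} [Fintype ι] (g : ι → E) :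
    Module.Dual k (ι →₀ k) →ₗ[k] E :=
  ∑ a, (LinearMap.applyₗ (Finsupp.single a 1)).smulRight (g a)

theorem dualMap_apply {ι : Type*} [Fintype ι] (g : ι → E) (φ : Module.Dual k (ι →₀ k)) :
    dualMap g φ = ∑ a, φ (Finsupp.single a 1) • g a := by
  simp [dualMap]

theorem dualMap_lapply {ι : Type*} [Fintype ι] (g : ι → E) (b : ι) :
    dualMap g (Finsupp.lapply b : Module.Dual k (ι →₀ k)) = g b := by
  classical
  rw [dualMap_apply, Finset.sum_eq_single b]
  · simp
  · intro a _ hab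
    rw [Finsupp.lapply_apply, Finsupp.single_eq_of_ne (by tauto), zero_smul]
  · simp

theorem mulMap_dualMap {ι : Type*} [Fintype ι] (g : ι → E)
    (f : Module.Dual k (ι →₀ k) ⊗[k] Module.Dual k (ι →₀ k)) :
    QuadAlg.mulMap (dualMap g) f = ∑ a, ∑ b, TensorProduct.dualDistrib k _ _ f
      (Finsupp.single a 1 ⊗ₜ Finsupp.single b 1) • (g a * g b) := by
  induction f with
  | zero => simp
  | add f f' h h' =>
    simp only [map_add, h, h', LinearMap.add_apply, add_smul, Finset.sum_add_distrib]
  | tmul φ ψ =>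
    rw [QuadAlg.mulMap_tmul, dualMap_apply, dualMap_apply, Finset.sum_mul_sum]
    simp only [TensorProduct.dualDistrib_apply, smul_mul_smul_comm]

-- The coefficients of f in the dual basis are its values on pairs of basis vectors, and the scalar
-- identities defining R^⊥ are exactly the coefficient hypotheses of `quadratic_eq_zero`.
open scoped Classical in
theorem IsDualSystem.mulMap_eq_zero {ε : k} {x : Fin n → E} {y : Γ.edgeSet → E}
    (S : IsDualSystem ε x y) (f : Module.Dual k (Gens k Γ) ⊗[k] Module.Dual k (Gens k Γ))
    (hf : f ∈ QuadAlg.dualRel (rel k Γ ε)) :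
    QuadAlg.mulMap (dualMap (Sum.elim x y)) f = 0 := by
  obtain ⟨h1, h2, h3⟩ := mem_dualRel_rel.mp hf
  set B := TensorProduct.dualDistrib k _ _ f with hB
  have hb0 : ∀ b c, ¬ Γ.Adj b c → uu k Γ b c = 0 := fun b c => uu_of_not_adj
  have key := S.quadratic_eq_zero (fun i j => B (u k Γ i ⊗ₜ u k Γ j))
    (fun i b c => B (u k Γ i ⊗ₜ uu k Γ b c)) (fun b c i => B (uu k Γ b c ⊗ₜ u k Γ i))
    (fun i j b c => B (uu k Γ i j ⊗ₜ uu k Γ b c))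
    (fun i b c h => by simp [hb0 _ _ h]) (fun i b c => by simp only [uu_symm b c])
    (fun b c i h => by simp [hb0 _ _ h]) (fun b c i => by simp only [uu_symm b c])
    (fun i j b c h => by simp [hb0 _ _ h]) (fun i j b c h => by simp [hb0 _ _ h])
    (fun i j b c => by simp only [uu_symm i j]) (fun i j b c => by simp only [uu_symm b c])
    (fun i j hij => by
      have := h1 i j hij
      simp only [comm, TensorProduct.tmul_sub, map_sub, map_smul, smul_eq_mul] at this
      linear_combination this)
    (fun i j l hij hil hjl => by
      have := h2 i j l hij hil hjl
      simp only [comm, TensorProduct.tmul_sub, map_add, map_sub, map_smul, smul_eq_mul] at this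
      rw [uu_symm j i]
      linear_combination this)
    (fun i j l m a b c d e g => by
      have := h3 i j l m a b c d e g
      simp only [comm, map_sub] at this
      exact sub_eq_zero.mp this)
  rw [mulMap_dualMap, Fintype.sum_sum_type]
  simp only [Fintype.sum_sum_type, Sum.elim_inl, Sum.elim_inr, Finset.sum_add_distrib]
  refine Eq.trans ?_ key
  rw [add_assoc, add_assoc, add_assoc]
  have eqv : ∀ i, (Finsupp.single (Sum.inl i) 1 : Gens k Γ) = u k Γ i := fun _ => rfl
  congr 1
  congr 1
  · refine Finset.sum_congr rfl fun i _ => ?_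
    refine sum_edgeSet _ (fun b c => B (u k Γ i ⊗ₜ uu k Γ b c) • (x i * extendEdge y b c)) ?_ ?_
    · intro b c h
      simp only [uu_of_adj h, extendEdge_of_adj y h, eqv, hB]
    · intro b c h
      simp [uu_of_not_adj h]
  congr 1
  · refine sum_edgeSet _
      (fun b c => ∑ i, B (uu k Γ b c ⊗ₜ u k Γ i) • (extendEdge y b c * x i)) ?_ ?_
    · intro b c h
      simp only [uu_of_adj h, extendEdge_of_adj y h, eqv, hB]
    · intro b c h
      simp [uu_of_not_adj h]
  · rw [Finset.sum_comm]
    refine sum_edgeSet _ (fun b c => ∑ i, ∑ j, if j < i then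
      B (uu k Γ i j ⊗ₜ uu k Γ b c) • (extendEdge y i j * extendEdge y b c) else 0) ?_ ?_
    · intro b c h
      symm
      refine sum_edgeSet _
        (fun i j => B (uu k Γ i j ⊗ₜ uu k Γ b c) • (extendEdge y i j * extendEdge y b c)) ?_ ?_
      · intro i j h'
        simp only [uu_of_adj h, extendEdge_of_adj y h, uu_of_adj h', extendEdge_of_adj y h', hB]
      · intro i j h'
        simp [uu_of_not_adj h']
    · intro b c h
      simp [uu_of_not_adj h]

open scoped Classical in
/-- The homomorphism from the quadratic dual defined by a system satisfying its relations. -/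
noncomputable def IsDualSystem.lift {ε : k} {x : Fin n → E} {y : Γ.edgeSet → E}
    (S : IsDualSystem ε x y) : QuadAlg (QuadAlg.dualRel (rel k Γ ε)) →ₐ[k] E :=
  QuadAlg.lift _ (dualMap (Sum.elim x y)) S.mulMap_eq_zero

theorem IsDualSystem.lift_dualGen {ε : k} {x : Fin n → E} {y : Γ.edgeSet → E}
    (S : IsDualSystem ε x y) (a : Fin n ⊕ Γ.edgeSet) :
    S.lift (dualGen ε a) = Sum.elim x y a := by
  classical
  rw [IsDualSystem.lift, dualGen, QuadAlg.lift_gen, dualMap_lapply]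

end GraphAlg

/-! ### Creation and annihilation operators on a Fock space with an exclusion rule. -/

set_option linter.unusedSectionVars false

namespace GraphAlg

section Fock

variable {k : Type*} [Field k] {ι V : Type*} [DecidableEq ι] [DecidableEq V]
variable (s : ι → Finset V) (rk : ι → ℕ)

variable (k ι) in
/-- The vector space with basis the finite sets of generators. -/
def FockSpace : Type _ := Finset ι →₀ k

noncomputable instance : AddCommGroup (FockSpace k ι) :=
  inferInstanceAs (AddCommGroup (Finset ι →₀ k))

noncomputable instance : Module k (FockSpace k ι) :=
  inferInstanceAs (Module k (Finset ι →₀ k))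

variable (k ι) in
/-- The standard basis of the Fock space. -/
noncomputable def fockBasis : Module.Basis (Finset ι) k (FockSpace k ι) :=
  (Finsupp.basisSingleOne : Module.Basis (Finset ι) k (Finset ι →₀ k))

theorem fockSpace_end_ext {f g : Module.End k (FockSpace k ι)}
    (h : ∀ A, f (fockBasis k ι A) = g (fockBasis k ι A)) : f = g :=
  (fockBasis k ι).ext h

variable (k) in
/-- The sign `(-1) ^ #{b ∈ A | b < a}`. -/
def fockSign (a : ι) (A : Finset ι) : k := (-1) ^ (A.filter fun b => rk b < rk a).card

theorem fockSign_insert (a b : ι) (A : Finset ι) (hb : b ∉ A) :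
    fockSign k rk a (insert b A) = (if rk b < rk a then -1 else 1) * fockSign k rk a A := by
  unfold fockSign
  rw [Finset.filter_insert]
  split_ifs
  · rw [Finset.card_insert_of_notMem (by simp [hb]), pow_succ']
  · rw [one_mul]

theorem fockSign_mul_self (a : ι) (A : Finset ι) :
    fockSign k rk a A * fockSign k rk a A = 1 := by
  unfold fockSign
  rw [← mul_pow]
  simp

theorem fockSign_exchange (hrk : Function.Injective rk) {a b : ι} (hab : a ≠ b) :
    (if rk b < rk a then -1 else 1 : k) = -(if rk a < rk b then -1 else 1) := by
  rcases lt_or_gt_of_ne (hrk.ne hab) with h | h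
  · simp [h, h.not_gt]
  · simp [h, h.not_gt]

variable (k) in
/-- The creation operator of `a` on the space with basis the finite sets of generators; it
vanishes on the sets whose support meets the support of `a`. -/
noncomputable def create (a : ι) : Module.End k (FockSpace k ι) :=
  (fockBasis k ι).constr k fun A : Finset ι =>
    if ∀ b ∈ A, Disjoint (s a) (s b) then fockSign k rk a A • fockBasis k ι (insert a A) else 0

variable (k) in
/-- The annihilation operator of `a`. -/
noncomputable def annihilate (a : ι) : Module.End k (FockSpace k ι) :=
  (fockBasis k ι).constr k fun A : Finset ι =>
    if a ∈ A then fockSign k rk a (A.erase a) • fockBasis k ι (A.erase a) else 0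

variable (k) in
/-- The projection to the sets whose support contains `v`. -/
noncomputable def touch (v : V) : Module.End k (FockSpace k ι) :=
  (fockBasis k ι).constr k fun A : Finset ι =>
    if ∃ b ∈ A, v ∈ s b then fockBasis k ι A else 0

variable {s rk}

theorem create_single {a : ι} {A : Finset ι} (h : ∀ b ∈ A, Disjoint (s a) (s b)) :
    create k s rk a (fockBasis k ι A) =
      fockSign k rk a A • fockBasis k ι (insert a A) := by
  rw [create, Module.Basis.constr_basis, if_pos h]

theorem create_single_of_not {a : ι} {A : Finset ι} (h : ¬ ∀ b ∈ A, Disjoint (s a) (s b)) :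
    create k s rk a (fockBasis k ι A) = 0 := by
  rw [create, Module.Basis.constr_basis, if_neg h]

theorem annihilate_single {a : ι} {A : Finset ι} (h : a ∉ A) :
    annihilate k rk a (fockBasis k ι (insert a A)) =
      fockSign k rk a A • fockBasis k ι A := by
  rw [annihilate, Module.Basis.constr_basis, if_pos (by simp),
    Finset.erase_insert h]

theorem annihilate_create_single (hs : ∀ a, (s a).Nonempty) {a : ι} {A : Finset ι}
    (h : ∀ b ∈ A, Disjoint (s a) (s b)) :
    annihilate k rk a (create k s rk a (fockBasis k ι A)) = fockBasis k ι A := by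
  have ha : a ∉ A := fun ha => (hs a).ne_empty (disjoint_self.mp (h a ha))
  rw [create_single h, map_smul, annihilate_single ha, smul_smul, fockSign_mul_self, one_smul]

theorem annihilate_single_of_notMem {a : ι} {A : Finset ι} (h : a ∉ A) :
    annihilate k rk a (fockBasis k ι A) = 0 := by
  rw [annihilate, Module.Basis.constr_basis, if_neg h]

theorem touch_single {v : V} {A : Finset ι} (h : ∃ b ∈ A, v ∈ s b) :
    touch k s v (fockBasis k ι A) = fockBasis k ι A := by
  rw [touch, Module.Basis.constr_basis, if_pos h]

theorem touch_single_of_not {v : V} {A : Finset ι} (h : ¬ ∃ b ∈ A, v ∈ s b) :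
    touch k s v (fockBasis k ι A) = 0 := by
  rw [touch, Module.Basis.constr_basis, if_neg h]

theorem create_mul_create_of_not_disjoint {a b : ι} (h : ¬ Disjoint (s a) (s b)) :
    create k s rk a * create k s rk b = 0 := by
  refine fockSpace_end_ext fun A => ?_
  rw [Module.End.mul_apply, LinearMap.zero_apply]
  by_cases hb : ∀ c ∈ A, Disjoint (s b) (s c)
  · rw [create_single hb, map_smul, create_single_of_not, smul_zero]
    exact fun h' => h (h' b (Finset.mem_insert_self _ _))
  · rw [create_single_of_not hb, map_zero]

theorem create_mul_create_single_of_not {a b : ι} {A : Finset ι}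
    (h : ¬ ∀ c ∈ A, Disjoint (s a) (s c)) :
    (create k s rk a * create k s rk b) (fockBasis k ι A) = 0 := by
  rw [Module.End.mul_apply]
  by_cases hb : ∀ c ∈ A, Disjoint (s b) (s c)
  · rw [create_single hb, map_smul, create_single_of_not, smul_zero]
    exact fun h' => h fun c hc => h' c (Finset.mem_insert_of_mem hc)
  · rw [create_single_of_not hb, map_zero]

theorem notMem_of_disjoint (hs : ∀ a, (s a).Nonempty) {a : ι} {A : Finset ι}
    (h : ∀ b ∈ A, Disjoint (s a) (s b)) : a ∉ A := fun ha =>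
  (hs a).ne_empty (disjoint_self.mp (h a ha))

theorem ne_of_disjoint_support (hs : ∀ a, (s a).Nonempty) {a b : ι}
    (h : Disjoint (s a) (s b)) : a ≠ b := by
  rintro rfl
  exact (hs a).ne_empty (disjoint_self.mp h)

/-- Of two distinct generators exactly one precedes the other, so inserting each before the other
changes exactly one of the two signs. If the supports meet, in particular if a = b, both products
vanish. -/
theorem create_anticomm (hrk : Function.Injective rk) (hs : ∀ a, (s a).Nonempty) (a b : ι) :
    create k s rk a * create k s rk b = -(create k s rk b * create k s rk a) := by
  by_cases hab : Disjoint (s a) (s b)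
  swap
  · rw [create_mul_create_of_not_disjoint hab,
      create_mul_create_of_not_disjoint fun h => hab h.symm]
    exact neg_zero.symm
  have hne := ne_of_disjoint_support hs hab
  refine fockSpace_end_ext fun A => ?_
  rw [LinearMap.neg_apply]
  by_cases ha : ∀ c ∈ A, Disjoint (s a) (s c)
  · by_cases hb : ∀ c ∈ A, Disjoint (s b) (s c)
    · have haA := notMem_of_disjoint hs ha
      have hbA := notMem_of_disjoint hs hb
      have ha' : ∀ c ∈ insert b A, Disjoint (s a) (s c) := by
        simpa using ⟨hab, ha⟩
      have hb' : ∀ c ∈ insert a A, Disjoint (s b) (s c) := by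
        simpa using ⟨hab.symm, hb⟩
      rw [Module.End.mul_apply, Module.End.mul_apply, create_single ha, create_single hb, map_smul,
        map_smul, create_single ha', create_single hb', fockSign_insert _ _ _ _ hbA,
        fockSign_insert _ _ _ _ haA, Finset.insert_comm, fockSign_exchange rk hrk hne, smul_smul,
        smul_smul, ← neg_smul]
      congr 1
      ring
    · rw [create_mul_create_single_of_not hb, Module.End.mul_apply, create_single_of_not hb]
      simp
  · rw [create_mul_create_single_of_not ha, Module.End.mul_apply, create_single_of_not ha]
    simp

theorem touch_mul_create_of_mem {v : V} {a : ι} (h : v ∈ s a) :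
    touch k s v * create k s rk a = create k s rk a := by
  refine fockSpace_end_ext fun A => ?_
  rw [Module.End.mul_apply]
  by_cases ha : ∀ c ∈ A, Disjoint (s a) (s c)
  · rw [create_single ha, map_smul, touch_single ⟨a, by simp, h⟩]
  · rw [create_single_of_not ha, map_zero]

theorem create_mul_touch_of_mem {v : V} {a : ι} (h : v ∈ s a) :
    create k s rk a * touch k s v = 0 := by
  refine fockSpace_end_ext fun A => ?_
  rw [Module.End.mul_apply, LinearMap.zero_apply]
  by_cases hv : ∃ b ∈ A, v ∈ s b
  · rw [touch_single hv, create_single_of_not]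
    obtain ⟨b, hb, hvb⟩ := hv
    exact fun h' => Finset.disjoint_left.mp (h' b hb) h hvb
  · rw [touch_single_of_not hv, map_zero]

theorem touch_mul_create_of_notMem {v : V} {a : ι} (h : v ∉ s a) :
    touch k s v * create k s rk a = create k s rk a * touch k s v := by
  refine fockSpace_end_ext fun A => ?_
  rw [Module.End.mul_apply, Module.End.mul_apply]
  have hiff : (∃ b ∈ insert a A, v ∈ s b) ↔ ∃ b ∈ A, v ∈ s b := by simp [h]
  by_cases hv : ∃ b ∈ A, v ∈ s b
  · rw [touch_single hv]
    by_cases ha : ∀ c ∈ A, Disjoint (s a) (s c)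
    · rw [create_single ha, map_smul, touch_single (hiff.mpr hv)]
    · rw [create_single_of_not ha, map_zero]
  · rw [touch_single_of_not hv, map_zero]
    by_cases ha : ∀ c ∈ A, Disjoint (s a) (s c)
    · rw [create_single ha, map_smul, touch_single_of_not fun h => hv (hiff.mp h), smul_zero]
    · rw [create_single_of_not ha, map_zero]

theorem touch_mul_touch (v w : V) :
    touch k s v * touch k s w = touch k s w * touch k s v := by
  refine fockSpace_end_ext fun A => ?_
  rw [Module.End.mul_apply, Module.End.mul_apply]
  by_cases hv : ∃ b ∈ A, v ∈ s b <;> by_cases hw : ∃ b ∈ A, w ∈ s b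
  · rw [touch_single hw, touch_single hv, touch_single hw]
  · rw [touch_single_of_not hw, touch_single hv, touch_single_of_not hw, map_zero]
  · rw [touch_single hw, touch_single_of_not hv, map_zero]
  · rw [touch_single_of_not hw, touch_single_of_not hv, map_zero, map_zero]

theorem touch_mul_self (v : V) : touch k s v * touch k s v = touch k s v := by
  refine fockSpace_end_ext fun A => ?_
  rw [Module.End.mul_apply]
  by_cases hv : ∃ b ∈ A, v ∈ s b
  · rw [touch_single hv, touch_single hv]
  · rw [touch_single_of_not hv, map_zero]

/-- Disjoint supports are required, not merely a ≠ b: removing a generator whose support meets that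
of b could make the creation of b possible. The disjointness of triangles enters the proof through
this condition. -/
theorem annihilate_mul_create_of_disjoint (hrk : Function.Injective rk)
    (hs : ∀ a, (s a).Nonempty) {a b : ι} (hab : Disjoint (s a) (s b)) :
    annihilate k rk a * create k s rk b = -(create k s rk b * annihilate k rk a) := by
  have hne := ne_of_disjoint_support hs hab
  refine fockSpace_end_ext fun A => ?_
  rw [LinearMap.neg_apply, Module.End.mul_apply, Module.End.mul_apply]
  by_cases ha : a ∈ A
  · obtain ⟨C, haC, rfl⟩ : ∃ C, a ∉ C ∧ insert a C = A :=
      ⟨A.erase a, Finset.notMem_erase _ _, Finset.insert_erase ha⟩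
    rw [annihilate_single haC, map_smul]
    by_cases hb : ∀ c ∈ C, Disjoint (s b) (s c)
    · have hb' : ∀ c ∈ insert a C, Disjoint (s b) (s c) := by
        simpa using ⟨hab.symm, hb⟩
      have hbC := notMem_of_disjoint hs hb
      rw [create_single hb, create_single hb', map_smul, Finset.insert_comm, annihilate_single
        (by simp [hne, haC]), fockSign_insert _ _ _ _ haC, fockSign_insert _ _ _ _ hbC,
        fockSign_exchange rk hrk hne, smul_smul, smul_smul, ← neg_smul]
      congr 1
      rcases lt_or_gt_of_ne (hrk.ne hne) with h | h
      · simp [h, mul_comm]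
      · simp [h.not_gt, mul_comm]
    · have hb' : ¬ ∀ c ∈ insert a C, Disjoint (s b) (s c) := fun h =>
        hb fun c hc => h c (Finset.mem_insert_of_mem hc)
      rw [create_single_of_not hb, create_single_of_not hb']
      simp
  · rw [annihilate_single_of_notMem ha, map_zero, neg_zero]
    by_cases hb : ∀ c ∈ A, Disjoint (s b) (s c)
    · rw [create_single hb, map_smul, annihilate_single_of_notMem (by simp [hne, ha]), smul_zero]
    · rw [create_single_of_not hb, map_zero]

end Fock
end GraphAlg

/-! ### The operators of vertices and edges and their relations. -/

namespace GraphAlg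

section Operators

variable {k : Type*} [Field k] {n : ℕ} {Γ : SimpleGraph (Fin n)}

/-- The vertices on which a generator lives. -/
def support : Fin n ⊕ Γ.edgeSet → Finset (Fin n)
  | Sum.inl i => {i}
  | Sum.inr e => e.1.toFinset

theorem support_edge {i j : Fin n} (h : Γ.Adj i j) :
    support (Sum.inr ⟨s(i, j), h⟩ : Fin n ⊕ Γ.edgeSet) = {i, j} := by
  ext v
  simp [support]

theorem support_vertex (i : Fin n) : support (Sum.inl i : Fin n ⊕ Γ.edgeSet) = {i} := rfl

theorem support_nonempty (a : Fin n ⊕ Γ.edgeSet) : (support a).Nonempty := by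
  rcases a with i | ⟨⟨i, j⟩, h⟩
  · exact ⟨i, by simp [support]⟩
  · exact ⟨i, by simp [support]⟩

/-- An enumeration of the generators. -/
noncomputable def rank : Fin n ⊕ Γ.edgeSet → ℕ :=
  (exists_injective_nat (Fin n ⊕ Γ.edgeSet)).choose

theorem rank_injective : Function.Injective (rank (Γ := Γ)) :=
  (exists_injective_nat (Fin n ⊕ Γ.edgeSet)).choose_spec

variable (k Γ) in
/-- The space with basis the finite sets of generators. -/
abbrev Fock : Type _ := FockSpace k (Fin n ⊕ Γ.edgeSet)

open scoped Classical in
variable (k Γ) in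
/-- The creation operator of a vertex. -/
noncomputable def vertexOp (i : Fin n) : Module.End k (Fock k Γ) :=
  create k support rank (Sum.inl i)

open scoped Classical in
variable (k Γ) in
/-- The creation operator of an edge. -/
noncomputable def edgeCreate (e : Γ.edgeSet) : Module.End k (Fock k Γ) :=
  create k support rank (Sum.inr e)

open scoped Classical in
variable (k Γ) in
/-- The projection to the sets of generators whose support contains `v`. -/
noncomputable def proj (v : Fin n) : Module.End k (Fock k Γ) :=
  touch k support v

/-- The operator of the generator dual to `u_{ij}`. -/
noncomputable def edgeOp (ε : k) (e : Γ.edgeSet) : Module.End k (Fock k Γ) :=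
  edgeCreate k Γ e + ε • ∑ i ∈ e.1.toFinset, ∑ j ∈ e.1.toFinset, vertexOp k Γ i * proj k Γ j

theorem vertexOp_anticomm (i j : Fin n) :
    vertexOp k Γ i * vertexOp k Γ j = -(vertexOp k Γ j * vertexOp k Γ i) :=
  create_anticomm rank_injective support_nonempty _ _

theorem edgeCreate_mul_vertexOp (i : Fin n) (e : Γ.edgeSet) :
    edgeCreate k Γ e * vertexOp k Γ i = -(vertexOp k Γ i * edgeCreate k Γ e) :=
  create_anticomm rank_injective support_nonempty _ _

theorem edgeCreate_anticomm (e f : Γ.edgeSet) :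
    edgeCreate k Γ e * edgeCreate k Γ f = -(edgeCreate k Γ f * edgeCreate k Γ e) :=
  create_anticomm rank_injective support_nonempty _ _

theorem vertexOp_sq (i : Fin n) : vertexOp k Γ i * vertexOp k Γ i = 0 :=
  create_mul_create_of_not_disjoint (by simp [support])

theorem vertexOp_mul_edgeCreate {i : Fin n} {e : Γ.edgeSet} (h : i ∈ e.1) :
    vertexOp k Γ i * edgeCreate k Γ e = 0 :=
  create_mul_create_of_not_disjoint (by simpa [support] using h)

theorem edgeCreate_mul_edgeCreate {v : Fin n} {e f : Γ.edgeSet} (h : v ∈ e.1) (h' : v ∈ f.1) :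
    edgeCreate k Γ e * edgeCreate k Γ f = 0 := by
  have h1 : v ∈ support (Sum.inr e : Fin n ⊕ Γ.edgeSet) := by simpa [support] using h
  have h2 : v ∈ support (Sum.inr f : Fin n ⊕ Γ.edgeSet) := by simpa [support] using h'
  exact create_mul_create_of_not_disjoint fun hd => Finset.disjoint_left.mp hd h1 h2

theorem proj_mul_vertexOp_self (i : Fin n) : proj k Γ i * vertexOp k Γ i = vertexOp k Γ i :=
  touch_mul_create_of_mem (by simp [support])

theorem vertexOp_mul_proj_self (i : Fin n) : vertexOp k Γ i * proj k Γ i = 0 :=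
  create_mul_touch_of_mem (by simp [support])

theorem proj_mul_vertexOp {i j : Fin n} (h : i ≠ j) :
    proj k Γ i * vertexOp k Γ j = vertexOp k Γ j * proj k Γ i :=
  touch_mul_create_of_notMem (by simpa [support] using h)

theorem proj_mul_edgeCreate_of_mem {i : Fin n} {e : Γ.edgeSet} (h : i ∈ e.1) :
    proj k Γ i * edgeCreate k Γ e = edgeCreate k Γ e :=
  touch_mul_create_of_mem (by simpa [support] using h)

theorem edgeCreate_mul_proj_of_mem {i : Fin n} {e : Γ.edgeSet} (h : i ∈ e.1) :
    edgeCreate k Γ e * proj k Γ i = 0 :=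
  create_mul_touch_of_mem (by simpa [support] using h)

theorem proj_mul_edgeCreate {i : Fin n} {e : Γ.edgeSet} (h : i ∉ e.1) :
    proj k Γ i * edgeCreate k Γ e = edgeCreate k Γ e * proj k Γ i :=
  touch_mul_create_of_notMem (by simpa [support] using h)

theorem proj_comm (i j : Fin n) : proj k Γ i * proj k Γ j = proj k Γ j * proj k Γ i :=
  touch_mul_touch _ _

theorem proj_sq (i : Fin n) : proj k Γ i * proj k Γ i = proj k Γ i :=
  touch_mul_self _

/-- The diagonal terms of the double sum drop out, since creating a vertex kills every set already
touching it. -/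
theorem edgeOp_mk (ε : k) {i j : Fin n} (h : Γ.Adj i j) :
    edgeOp ε ⟨s(i, j), h⟩ = edgeCreate k Γ ⟨s(i, j), h⟩ +
      ε • (vertexOp k Γ i * proj k Γ j + vertexOp k Γ j * proj k Γ i) := by
  have hne := Γ.ne_of_adj h
  have : s(i, j).toFinset = {i, j} := by ext v; simp
  simp only [edgeOp, this]
  rw [Finset.sum_pair hne, Finset.sum_pair hne, Finset.sum_pair hne, vertexOp_mul_proj_self,
    vertexOp_mul_proj_self, zero_add, add_zero]

theorem vertexOp_mul_edgeOp (ε : k) {i j : Fin n} (h : Γ.Adj i j) :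
    vertexOp k Γ i * edgeOp ε ⟨s(i, j), h⟩ = 0 := by
  rw [edgeOp_mk, mul_add, vertexOp_mul_edgeCreate (by simp), mul_smul_comm, mul_add, ← mul_assoc,
    ← mul_assoc, vertexOp_sq, vertexOp_anticomm i j, neg_mul, mul_assoc, vertexOp_mul_proj_self]
  simp

/-- Once j has been created, p_j acts as the identity, so x_i p_j x_j = x_i x_j; every other term
contains x_j twice or creates an edge on top of its own endpoint. The correction term of `edgeOp` is
designed for this. -/
theorem edgeOp_mul_vertexOp_right (ε : k) {i j : Fin n} (h : Γ.Adj i j) :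
    edgeOp ε ⟨s(i, j), h⟩ * vertexOp k Γ j = ε • (vertexOp k Γ i * vertexOp k Γ j) := by
  rw [edgeOp_mk, add_mul, edgeCreate_mul_vertexOp, vertexOp_mul_edgeCreate (by simp),
    smul_mul_assoc, add_mul, mul_assoc, mul_assoc, proj_mul_vertexOp_self,
    proj_mul_vertexOp (Γ.ne_of_adj h), ← mul_assoc (vertexOp k Γ j), vertexOp_sq]
  simp

theorem edgeOp_mul_vertexOp (ε : k) {i j l : Fin n} (h : Γ.Adj i j) (hi : l ≠ i) (hj : l ≠ j) :
    edgeOp ε ⟨s(i, j), h⟩ * vertexOp k Γ l = -(vertexOp k Γ l * edgeOp ε ⟨s(i, j), h⟩) := by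
  rw [edgeOp_mk, add_mul, mul_add, edgeCreate_mul_vertexOp, smul_mul_assoc, mul_smul_comm,
    add_mul, mul_add, mul_assoc, mul_assoc, proj_mul_vertexOp hi.symm, proj_mul_vertexOp hj.symm,
    ← mul_assoc, ← mul_assoc, vertexOp_anticomm i l, vertexOp_anticomm j l]
  simp only [mul_assoc, neg_mul, neg_add, smul_neg, smul_add]

theorem edgeOp_sq (ε : k) {i j : Fin n} (h : Γ.Adj i j) :
    edgeOp ε ⟨s(i, j), h⟩ * edgeOp (k := k) ε ⟨s(i, j), h⟩ = 0 := by
  have h1 := vertexOp_mul_edgeOp (k := k) ε h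
  have e : (⟨s(i, j), h⟩ : Γ.edgeSet) = ⟨s(j, i), h.symm⟩ := Subtype.ext Sym2.eq_swap
  have h2 := vertexOp_mul_edgeOp (k := k) ε h.symm
  rw [← e] at h2
  -- The vertex operator moves past the projection and then kills the edge operator.
  have hp : ∀ a b : Fin n, a ≠ b → (a = i ∨ a = j) → (b = i ∨ b = j) →
      vertexOp k Γ a * proj k Γ b * edgeOp ε ⟨s(i, j), h⟩ = 0 := by
    intro a b hab ha hb
    have e1 : vertexOp k Γ a * edgeOp ε ⟨s(i, j), h⟩ = 0 := by
      rcases ha with rfl | rfl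
      · exact h1
      · exact h2
    have e2 : vertexOp k Γ a * proj k Γ b = proj k Γ b * vertexOp k Γ a :=
      (proj_mul_vertexOp hab.symm).symm
    rw [e2, mul_assoc, e1, mul_zero]
  conv_lhs => rw [edgeOp_mk ε h, add_mul, smul_mul_assoc, add_mul, ← edgeOp_mk ε h]
  rw [hp i j (Γ.ne_of_adj h) (by simp) (by simp), hp j i (Γ.ne_of_adj h).symm (by simp) (by simp),
    edgeOp_mk, mul_add, edgeCreate_mul_edgeCreate (v := i) (by simp) (by simp), mul_smul_comm,
    mul_add, ← mul_assoc, ← mul_assoc, edgeCreate_mul_vertexOp, edgeCreate_mul_vertexOp,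
    vertexOp_mul_edgeCreate (by simp), vertexOp_mul_edgeCreate (by simp)]
  simp

/-- The image of the operator of jl lies in the sets touching j, so p_j is the identity on it and
x_i p_j leaves the right-hand side. In the other term p_i commutes past the operator of jl, which
x_j then kills. -/
theorem edgeOp_mul_edgeOp (ε : k) {i j l : Fin n} (h : Γ.Adj i j) (h' : Γ.Adj j l) (hil : i ≠ l) :
    edgeOp ε ⟨s(i, j), h⟩ * edgeOp (k := k) ε ⟨s(j, l), h'⟩ =
      ε • (vertexOp k Γ i * edgeOp ε ⟨s(j, l), h'⟩) := by
  have hij := Γ.ne_of_adj h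
  have hjl := Γ.ne_of_adj h'
  have hj : proj k Γ j * edgeOp ε ⟨s(j, l), h'⟩ = edgeOp ε ⟨s(j, l), h'⟩ := by
    rw [edgeOp_mk, mul_add, proj_mul_edgeCreate_of_mem (by simp), mul_smul_comm, mul_add,
      ← mul_assoc, proj_mul_vertexOp_self, ← mul_assoc, proj_mul_vertexOp hjl, mul_assoc, proj_sq]
  have e0 : edgeCreate k Γ ⟨s(i, j), h⟩ * edgeOp ε ⟨s(j, l), h'⟩ = 0 := by
    rw [edgeOp_mk, mul_add, edgeCreate_mul_edgeCreate (v := j) (by simp) (by simp), mul_smul_comm,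
      mul_add, ← mul_assoc, ← mul_assoc, edgeCreate_mul_vertexOp, edgeCreate_mul_vertexOp,
      vertexOp_mul_edgeCreate (by simp), neg_mul, neg_mul, mul_assoc,
      edgeCreate_mul_proj_of_mem (by simp)]
    simp
  have e1 : proj k Γ i * edgeOp ε ⟨s(j, l), h'⟩ = edgeOp ε ⟨s(j, l), h'⟩ * proj k Γ i := by
    rw [edgeOp_mk, mul_add, add_mul, proj_mul_edgeCreate (by simp [hij, hil]), mul_smul_comm,
      smul_mul_assoc, mul_add, add_mul, ← mul_assoc, ← mul_assoc, proj_mul_vertexOp hij,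
      proj_mul_vertexOp hil, mul_assoc, mul_assoc, mul_assoc, mul_assoc, proj_comm i j,
      proj_comm i l]
  rw [edgeOp_mk ε h, add_mul, e0, zero_add, smul_mul_assoc, add_mul, mul_assoc, hj, mul_assoc, e1,
    ← mul_assoc (vertexOp k Γ j), vertexOp_mul_edgeOp, zero_mul, add_zero]

theorem edgeOp_anticomm (ε : k) {i j l m : Fin n} (h : Γ.Adj i j) (h' : Γ.Adj l m)
    (hil : i ≠ l) (him : i ≠ m) (hjl : j ≠ l) (hjm : j ≠ m) :
    edgeOp ε ⟨s(i, j), h⟩ * edgeOp (k := k) ε ⟨s(l, m), h'⟩ =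
      -(edgeOp ε ⟨s(l, m), h'⟩ * edgeOp ε ⟨s(i, j), h⟩) := by
  have hp : ∀ v, v ≠ l → v ≠ m →
      proj k Γ v * edgeOp ε ⟨s(l, m), h'⟩ = edgeOp ε ⟨s(l, m), h'⟩ * proj k Γ v := by
    intro v hl hm
    rw [edgeOp_mk, mul_add, add_mul, proj_mul_edgeCreate (by simp [hl, hm]), mul_smul_comm,
      smul_mul_assoc, mul_add, add_mul, ← mul_assoc, ← mul_assoc, proj_mul_vertexOp hl,
      proj_mul_vertexOp hm, mul_assoc, mul_assoc, mul_assoc, mul_assoc, proj_comm v l,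
      proj_comm v m]
  have hx : ∀ v w, v ≠ l → v ≠ m → w ≠ l → w ≠ m →
      vertexOp k Γ v * proj k Γ w * edgeOp ε ⟨s(l, m), h'⟩ =
        -(edgeOp ε ⟨s(l, m), h'⟩ * (vertexOp k Γ v * proj k Γ w)) := by
    intro v w hvl hvm hwl hwm
    rw [mul_assoc, hp w hwl hwm, ← mul_assoc, ← mul_assoc, edgeOp_mul_vertexOp ε h' hvl hvm]
    simp
  have hc : edgeCreate k Γ ⟨s(i, j), h⟩ * edgeOp ε ⟨s(l, m), h'⟩ =
      -(edgeOp ε ⟨s(l, m), h'⟩ * edgeCreate k Γ ⟨s(i, j), h⟩) := by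
    rw [edgeOp_mk, mul_add, add_mul, edgeCreate_anticomm, mul_smul_comm, smul_mul_assoc, mul_add,
      add_mul, ← mul_assoc, ← mul_assoc, edgeCreate_mul_vertexOp, edgeCreate_mul_vertexOp,
      neg_mul, neg_mul, mul_assoc, mul_assoc, mul_assoc, mul_assoc,
      proj_mul_edgeCreate (by simp [him.symm, hjm.symm]),
      proj_mul_edgeCreate (by simp [hil.symm, hjl.symm])]
    simp only [neg_add, smul_neg, smul_add]
  rw [edgeOp_mk ε h, add_mul, mul_add, hc, smul_mul_assoc, mul_smul_comm, add_mul, mul_add,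
    hx i j hil him hjl hjm, hx j i hjl hjm hil him]
  simp only [neg_add, smul_neg, smul_add]

end Operators
end GraphAlg

/-! ### Triangles and the operators of their relations. -/

namespace GraphAlg

variable {k : Type*} [Field k] {n : ℕ} {Γ : SimpleGraph (Fin n)}

variable (Γ) in
/-- The triangles of `Γ`, with increasing vertices. -/
structure Triangle where
  a : Fin n
  b : Fin n
  c : Fin n
  hab : a < b
  hbc : b < c
  adj_ab : Γ.Adj a b
  adj_bc : Γ.Adj b c
  adj_ac : Γ.Adj a c

namespace Triangle

theorem injective_vertices :
    Function.Injective (fun T : Triangle Γ => (T.a, T.b, T.c)) := by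
  rintro ⟨a, b, c, _, _, _, _, _⟩ ⟨a', b', c', _, _, _, _, _⟩ h
  simp only [Prod.mk.injEq] at h
  obtain ⟨rfl, rfl, rfl⟩ := h
  rfl

instance : Finite (Triangle Γ) := Finite.of_injective _ injective_vertices

/-- The set of vertices of a triangle. -/
def vertices (T : Triangle Γ) : Finset (Fin n) := {T.a, T.b, T.c}

theorem isNClique (T : Triangle Γ) : Γ.IsNClique 3 T.vertices :=
  SimpleGraph.is3Clique_triple_iff.mpr ⟨T.adj_ab, T.adj_ac, T.adj_bc⟩

theorem eq_of_vertices_eq {T U : Triangle Γ} (h : T.vertices = U.vertices) : T = U := by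
  apply injective_vertices
  obtain ⟨a, b, c, h1, h2, _, _, _⟩ := T
  obtain ⟨a', b', c', h3, h4, _, _, _⟩ := U
  simp only [vertices, Finset.ext_iff, Finset.mem_insert, Finset.mem_singleton] at h
  have ha := (h a).mp (by simp)
  have hb := (h b).mp (by simp)
  have hc := (h c).mp (by simp)
  have ha' := (h a').mpr (by simp)
  simp only [Prod.mk.injEq]
  refine ⟨?_, ?_, ?_⟩ <;> omega

theorem disjoint_vertices (hΓ : NoOverlappingTriangles Γ) {T U : Triangle Γ} (h : T ≠ U) :
    Disjoint T.vertices U.vertices :=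
  hΓ _ _ T.isNClique U.isNClique fun h' => h (eq_of_vertices_eq h')

/-- The edge `ab` of a triangle. -/
def edgeAB (T : Triangle Γ) : Γ.edgeSet := ⟨s(T.a, T.b), T.adj_ab⟩

/-- The edge `bc` of a triangle. -/
def edgeBC (T : Triangle Γ) : Γ.edgeSet := ⟨s(T.b, T.c), T.adj_bc⟩

/-- The edge `ac` of a triangle. -/
def edgeAC (T : Triangle Γ) : Γ.edgeSet := ⟨s(T.a, T.c), T.adj_ac⟩

variable (k) in
/-- The operator on the Fock space given by the relation of a triangle. -/
noncomputable def op (T : Triangle Γ) : Module.End k (Fock k Γ) :=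
  vertexOp k Γ T.a * edgeCreate k Γ T.edgeBC + vertexOp k Γ T.b * edgeCreate k Γ T.edgeAC +
    vertexOp k Γ T.c * edgeCreate k Γ T.edgeAB

theorem support_edgeAB (T : Triangle Γ) :
    support (Sum.inr T.edgeAB : Fin n ⊕ Γ.edgeSet) = {T.a, T.b} := support_edge _

theorem support_edgeBC (T : Triangle Γ) :
    support (Sum.inr T.edgeBC : Fin n ⊕ Γ.edgeSet) = {T.b, T.c} := support_edge _

theorem support_edgeAC (T : Triangle Γ) :
    support (Sum.inr T.edgeAC : Fin n ⊕ Γ.edgeSet) = {T.a, T.c} := support_edge _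

theorem comm_mul_of_anticomm {R : Type*} [Ring R] {c x y : R} (hx : c * x = -(x * c))
    (hy : c * y = -(y * c)) : c * (x * y) = x * y * c := by
  rw [← mul_assoc, hx, neg_mul, mul_assoc, hy, mul_neg, neg_neg, mul_assoc]

/-- `op` is quadratic in anticommuting creation operators, hence commutes with every creation
operator. -/
theorem vertexOp_mul_op (i : Fin n) (T : Triangle Γ) :
    vertexOp k Γ i * T.op k = T.op k * vertexOp k Γ i := by
  have h : ∀ (j : Fin n) (e : Γ.edgeSet),
      vertexOp k Γ i * (vertexOp k Γ j * edgeCreate k Γ e) =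
        vertexOp k Γ j * edgeCreate k Γ e * vertexOp k Γ i := fun j e =>
    comm_mul_of_anticomm (vertexOp_anticomm i j) (by rw [edgeCreate_mul_vertexOp, neg_neg])
  simp only [op, mul_add, add_mul, h]

theorem edgeCreate_mul_op (e : Γ.edgeSet) (T : Triangle Γ) :
    edgeCreate k Γ e * T.op k = T.op k * edgeCreate k Γ e := by
  have h : ∀ (j : Fin n) (f : Γ.edgeSet),
      edgeCreate k Γ e * (vertexOp k Γ j * edgeCreate k Γ f) =
        vertexOp k Γ j * edgeCreate k Γ f * edgeCreate k Γ e := fun j f =>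
    comm_mul_of_anticomm (edgeCreate_mul_vertexOp j e) (edgeCreate_anticomm e f)
  simp only [op, mul_add, add_mul, h]

/-- Each of the three summands covers all three vertices of the triangle. -/
theorem proj_mul_op_of_mem {v : Fin n} {T : Triangle Γ} (hv : v ∈ T.vertices) :
    proj k Γ v * T.op k = T.op k := by
  have h : ∀ (j : Fin n) (e : Γ.edgeSet), (v = j ∨ v ∈ e.1) →
      proj k Γ v * (vertexOp k Γ j * edgeCreate k Γ e) =
        vertexOp k Γ j * edgeCreate k Γ e := by
    intro j e hve
    by_cases hj : v = j
    · rw [hj, ← mul_assoc, proj_mul_vertexOp_self]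
    · rw [← mul_assoc, proj_mul_vertexOp hj, mul_assoc,
        proj_mul_edgeCreate_of_mem (hve.resolve_left hj)]
  simp only [vertices, Finset.mem_insert, Finset.mem_singleton] at hv
  rw [op, mul_add, mul_add, h, h, h] <;> simp only [edgeAB, edgeBC, edgeAC, Sym2.mem_iff] <;> tauto

theorem proj_mul_op_of_notMem {v : Fin n} {T : Triangle Γ} (hv : v ∉ T.vertices) :
    proj k Γ v * T.op k = T.op k * proj k Γ v := by
  have h : ∀ (j : Fin n) (e : Γ.edgeSet), v ≠ j → v ∉ e.1 →
      proj k Γ v * (vertexOp k Γ j * edgeCreate k Γ e) =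
        vertexOp k Γ j * edgeCreate k Γ e * proj k Γ v := by
    intro j e hj he
    rw [← mul_assoc, proj_mul_vertexOp hj, mul_assoc, proj_mul_edgeCreate he, mul_assoc]
  obtain ⟨ha, hb, hc⟩ : v ≠ T.a ∧ v ≠ T.b ∧ v ≠ T.c := by simpa [vertices] using hv
  rw [op, mul_add, mul_add, add_mul, add_mul, h _ _ ha (by simp [edgeBC, hb, hc]),
    h _ _ hb (by simp [edgeAC, ha, hc]), h _ _ hc (by simp [edgeAB, ha, hb])]

/-- The relation of a triangle only involves the creation operators. -/
theorem op_eq (ε : k) (T : Triangle Γ) :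
    vertexOp k Γ T.a * edgeOp ε T.edgeBC + vertexOp k Γ T.b * edgeOp ε T.edgeAC +
      vertexOp k Γ T.c * edgeOp ε T.edgeAB = T.op k := by
  simp only [edgeBC, edgeAC, edgeAB, edgeOp_mk, op, mul_add, mul_smul_comm, ← mul_assoc]
  -- The six ε-terms x_v x_w p_u cancel in pairs after sorting the vertex operators.
  rw [vertexOp_anticomm T.b T.a, vertexOp_anticomm T.c T.a, vertexOp_anticomm T.c T.b]
  simp only [neg_mul, smul_add, smul_neg]
  abel

/-- The operator removing the edge `ab` and the vertex `c`. -/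
noncomputable def annihilatePair (T : Triangle Γ) : Module.End k (Fock k Γ) :=
  open scoped Classical in
  annihilate k rank (Sum.inr T.edgeAB) * annihilate k rank (Sum.inl T.c)

/-- Everything created by U is supported away from everything removed by T, so each annihilator
anticommutes with both factors in each summand of `op` and commutes with their product. -/
theorem annihilatePair_mul_op (hΓ : NoOverlappingTriangles Γ) {T U : Triangle Γ} (h : T ≠ U) :
    annihilatePair (k := k) T * U.op k = U.op k * annihilatePair T := by
  classical
  have hd := disjoint_vertices hΓ h
  have hc : ∀ x y : Fin n ⊕ Γ.edgeSet, support x ⊆ T.vertices → support y ⊆ U.vertices →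
      annihilate k rank x * create k support rank y =
        -(create k support rank y * annihilate k rank x) := fun x y hx hy =>
    annihilate_mul_create_of_disjoint rank_injective support_nonempty
      (Finset.disjoint_of_subset_left hx (Finset.disjoint_of_subset_right hy hd))
  have hcc : ∀ x y z : Fin n ⊕ Γ.edgeSet, support x ⊆ T.vertices → support y ⊆ U.vertices →
      support z ⊆ U.vertices →
      annihilate k rank x * (create k support rank y * create k support rank z) =
        create k support rank y * create k support rank z * annihilate k rank x :=
    fun x y z hx hy hz => comm_mul_of_anticomm (hc x y hx hy) (hc x z hx hz)
  have key : ∀ x : Fin n ⊕ Γ.edgeSet, support x ⊆ T.vertices →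
      annihilate k rank x * U.op k = U.op k * annihilate k rank x := by
    intro x hx
    simp only [op, vertexOp, edgeCreate, mul_add, add_mul]
    rw [hcc x _ _ hx, hcc x _ _ hx, hcc x _ _ hx] <;>
      simp [vertices, support_vertex, support_edgeAB, support_edgeBC, support_edgeAC,
        Finset.insert_subset_iff]
  have h1 := key (Sum.inl T.c) (by simp [vertices, support_vertex])
  have h2 := key (Sum.inr T.edgeAB) (by
    simp [vertices, support_edgeAB, Finset.insert_subset_iff])
  rw [annihilatePair, mul_assoc, h1, ← mul_assoc, h2, mul_assoc]

/-- `annihilatePair` is a generalized inverse of `op`. On a set disjoint from T only the summand x_c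
y_ab creates c, so removing c and ab recovers the set; a set meeting T is killed by `op` at once. -/
theorem op_mul_annihilatePair_mul_op (T : Triangle Γ) :
    T.op k * annihilatePair T * T.op k = T.op k := by
  classical
  have hab := T.hab
  have hbc := T.hbc
  have hac := hab.trans hbc
  refine fockSpace_end_ext fun A => ?_
  rw [Module.End.mul_apply, Module.End.mul_apply]
  by_cases hA : ∀ y ∈ A, Disjoint T.vertices (support y)
  · have hd : ∀ x : Fin n ⊕ Γ.edgeSet, support x ⊆ T.vertices →
        ∀ y ∈ A, Disjoint (support x) (support y) := fun x hx y hy =>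
      Finset.disjoint_of_subset_left hx (hA y hy)
    have ha := hd (Sum.inl T.a) (by simp [vertices, support_vertex])
    have hb := hd (Sum.inl T.b) (by simp [vertices, support_vertex])
    have hc := hd (Sum.inl T.c) (by simp [vertices, support_vertex])
    have hab' := hd (Sum.inr T.edgeAB)
      (by simp [vertices, support_edgeAB, Finset.insert_subset_iff])
    have hbc' := hd (Sum.inr T.edgeBC)
      (by simp [vertices, support_edgeBC])
    have hac' := hd (Sum.inr T.edgeAC)
      (by simp [vertices, support_edgeAC, Finset.insert_subset_iff])
    have hcA := notMem_of_disjoint support_nonempty hc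
    have e1 : annihilate k rank (Sum.inl T.c) ((vertexOp k Γ T.a * edgeCreate k Γ T.edgeBC)
        (fockBasis k _ A)) = 0 := by
      rw [Module.End.mul_apply, edgeCreate, create_single hbc', map_smul, vertexOp, create_single
        (by simpa [support_vertex, support_edgeBC, hab.ne, hac.ne] using ha), map_smul, map_smul,
        annihilate_single_of_notMem (by simp [hac.ne', hcA])]
      simp
    have e2 : annihilate k rank (Sum.inl T.c) ((vertexOp k Γ T.b * edgeCreate k Γ T.edgeAC)
        (fockBasis k _ A)) = 0 := by
      rw [Module.End.mul_apply, edgeCreate, create_single hac', map_smul, vertexOp, create_single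
        (by simpa [support_vertex, support_edgeAC, hab.ne', hbc.ne] using hb), map_smul, map_smul,
        annihilate_single_of_notMem (by simp [hbc.ne', hcA])]
      simp
    have e3 : annihilate k rank (Sum.inl T.c) ((vertexOp k Γ T.c * edgeCreate k Γ T.edgeAB)
        (fockBasis k _ A)) = edgeCreate k Γ T.edgeAB (fockBasis k _ A) := by
      rw [Module.End.mul_apply, edgeCreate, create_single hab', map_smul, vertexOp, map_smul,
        annihilate_create_single support_nonempty
        (by simpa [support_vertex, support_edgeAB, hac.ne', hbc.ne'] using hc)]
    have e4 : annihilatePair T (T.op k (fockBasis k _ A)) = fockBasis k _ A := by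
      rw [annihilatePair, Module.End.mul_apply]
      simp only [op, LinearMap.add_apply, map_add, e1, e2, e3, map_zero]
      rw [zero_add, zero_add, edgeCreate, annihilate_create_single support_nonempty hab']
    rw [e4]
  · have h0 : ∀ (j : Fin n) (e : Γ.edgeSet), T.vertices ⊆ insert j (support (Sum.inr e)) →
        (vertexOp k Γ j * edgeCreate k Γ e) (fockBasis k _ A) = 0 := by
      intro j e hsub
      by_cases he : ∀ y ∈ A, Disjoint (support (Sum.inr e)) (support y)
      · rw [vertexOp, edgeCreate, create_mul_create_single_of_not]
        intro hj
        refine hA fun y hy => Finset.disjoint_of_subset_left hsub ?_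
        rw [Finset.disjoint_insert_left]
        exact ⟨by simpa [support_vertex] using hj y hy, he y hy⟩
      · rw [Module.End.mul_apply, edgeCreate, create_single_of_not he, map_zero]
    have : T.op k (fockBasis k _ A) = 0 := by
      rw [op, LinearMap.add_apply, LinearMap.add_apply, h0, h0, h0, add_zero, add_zero]
      · simp [vertices, support_edgeAB, Finset.insert_subset_iff]
      · simp [vertices, support_edgeAC, Finset.insert_subset_iff]
      · simp [vertices, support_edgeBC]
    rw [this]
    simp

end Triangle

end GraphAlg

/-! ### The action modulo triangle relations, normal forms, and linear independence. -/

namespace GraphAlg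

variable {k : Type*} [Field k] {n : ℕ} {Γ : SimpleGraph (Fin n)}

namespace Triangle

/-- The local normal form operator of a triangle: it eliminates the monomials containing the
edge `ab` and the vertex `c`. -/
noncomputable def reduce (T : Triangle Γ) : Module.End k (Fock k Γ) :=
  1 - T.op k * annihilatePair T

theorem reduce_mul_op_self (T : Triangle Γ) : reduce (k := k) T * T.op k = 0 := by
  rw [reduce, sub_mul, one_mul, op_mul_annihilatePair_mul_op, sub_self]

theorem op_mul_op (T U : Triangle Γ) : T.op k * U.op k = U.op k * T.op k := by
  conv_lhs => rw [op, add_mul, add_mul]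
  simp only [mul_assoc, edgeCreate_mul_op]
  simp only [← mul_assoc, vertexOp_mul_op]
  simp only [op, mul_add, mul_assoc]

theorem reduce_mul_op (hΓ : NoOverlappingTriangles Γ) {T U : Triangle Γ} (h : T ≠ U) :
    reduce (k := k) T * U.op k = U.op k * reduce T := by
  rw [reduce, sub_mul, mul_sub, one_mul, mul_one, mul_assoc, annihilatePair_mul_op hΓ h,
    ← mul_assoc, op_mul_op, mul_assoc]

theorem reduce_basis (T : Triangle Γ) {A : Finset (Fin n ⊕ Γ.edgeSet)}
    (h : ¬ (Sum.inl T.c ∈ A ∧ Sum.inr T.edgeAB ∈ A)) :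
    reduce (k := k) T (fockBasis k _ A) = fockBasis k _ A := by
  classical
  have : annihilatePair (k := k) T (fockBasis k _ A) = 0 := by
    rw [annihilatePair, Module.End.mul_apply]
    by_cases hc : Sum.inl T.c ∈ A
    · obtain ⟨C, hC, rfl⟩ : ∃ C, Sum.inl T.c ∉ C ∧ insert (Sum.inl T.c) C = A :=
        ⟨A.erase _, Finset.notMem_erase _ _, Finset.insert_erase hc⟩
      rw [annihilate_single hC, map_smul, annihilate_single_of_notMem, smul_zero]
      exact fun h' => h ⟨hc, Finset.mem_insert_of_mem h'⟩
    · rw [annihilate_single_of_notMem hc, map_zero]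
  rw [reduce, LinearMap.sub_apply, Module.End.mul_apply, this, map_zero, sub_zero,
    Module.End.one_apply]

end Triangle

variable (k Γ) in
/-- The subspace of the Fock space generated by the triangle relations. -/
noncomputable def triangleSpan : Submodule k (Fock k Γ) :=
  Submodule.span k {m | ∃ (T : Triangle Γ) (m' : Fock k Γ), T.op k m' = m}

theorem op_mem_triangleSpan (T : Triangle Γ) (m : Fock k Γ) : T.op k m ∈ triangleSpan k Γ :=
  Submodule.subset_span ⟨T, m, rfl⟩

theorem triangleSpan_le_comap {f : Module.End k (Fock k Γ)}
    (h : ∀ (T : Triangle Γ) m, f (T.op k m) ∈ triangleSpan k Γ) :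
    triangleSpan k Γ ≤ (triangleSpan k Γ).comap f := by
  refine Submodule.span_le.mpr ?_
  rintro _ ⟨T, m, rfl⟩
  exact h T m

theorem vertexOp_op_mem (i : Fin n) (T : Triangle Γ) (m : Fock k Γ) :
    vertexOp k Γ i (T.op k m) ∈ triangleSpan k Γ := by
  rw [← Module.End.mul_apply, T.vertexOp_mul_op, Module.End.mul_apply]
  exact op_mem_triangleSpan _ _

/-- A projection is absorbed by `op` at a vertex of T and commutes with it elsewhere, so the span
stays stable under the ε-part of the edge operators. -/
theorem vertexOp_proj_op_mem (i j : Fin n) (T : Triangle Γ) (m : Fock k Γ) :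
    (vertexOp k Γ i * proj k Γ j) (T.op k m) ∈ triangleSpan k Γ := by
  rw [Module.End.mul_apply, ← Module.End.mul_apply (proj k Γ j)]
  by_cases hj : j ∈ T.vertices
  · rw [Triangle.proj_mul_op_of_mem hj]
    exact vertexOp_op_mem _ _ _
  · rw [Triangle.proj_mul_op_of_notMem hj, Module.End.mul_apply]
    exact vertexOp_op_mem _ _ _

theorem edgeOp_op_mem (ε : k) (e : Γ.edgeSet) (T : Triangle Γ) (m : Fock k Γ) :
    edgeOp ε e (T.op k m) ∈ triangleSpan k Γ := by
  obtain ⟨e, h⟩ := e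
  induction e using Sym2.ind with | _ i j
  rw [edgeOp_mk ε h, LinearMap.add_apply, LinearMap.smul_apply, LinearMap.add_apply]
  refine add_mem ?_ (Submodule.smul_mem _ _ (add_mem ?_ ?_))
  · rw [← Module.End.mul_apply, T.edgeCreate_mul_op, Module.End.mul_apply]
    exact op_mem_triangleSpan _ _
  · exact vertexOp_proj_op_mem _ _ _ _
  · exact vertexOp_proj_op_mem _ _ _ _

variable (k Γ) in
/-- The operator of a vertex modulo the triangle relations. -/
noncomputable def vertexOpQ (i : Fin n) : Module.End k (Fock k Γ ⧸ triangleSpan k Γ) :=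
  (triangleSpan k Γ).mapQ _ (vertexOp k Γ i) (triangleSpan_le_comap (vertexOp_op_mem i))

/-- The operator of an edge modulo the triangle relations. -/
noncomputable def edgeOpQ (ε : k) (e : Γ.edgeSet) :
    Module.End k (Fock k Γ ⧸ triangleSpan k Γ) :=
  (triangleSpan k Γ).mapQ _ (edgeOp ε e) (triangleSpan_le_comap (edgeOp_op_mem ε e))

theorem end_quotient_ext {f g : Module.End k (Fock k Γ ⧸ triangleSpan k Γ)}
    (h : ∀ m : Fock k Γ, f ((triangleSpan k Γ).mkQ m) = g ((triangleSpan k Γ).mkQ m)) : f = g := by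
  refine LinearMap.ext fun q => ?_
  obtain ⟨m, rfl⟩ := (triangleSpan k Γ).mkQ_surjective q
  exact h m

theorem vertexOpQ_mkQ (i : Fin n) (m : Fock k Γ) :
    vertexOpQ k Γ i ((triangleSpan k Γ).mkQ m) = (triangleSpan k Γ).mkQ (vertexOp k Γ i m) := rfl

theorem edgeOpQ_mkQ (ε : k) (e : Γ.edgeSet) (m : Fock k Γ) :
    edgeOpQ ε e ((triangleSpan k Γ).mkQ m) = (triangleSpan k Γ).mkQ (edgeOp ε e m) := rfl

/-- All relations except the last already hold on the Fock space; the quotient serves only to force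
the triangle relation. -/
theorem isDualSystem_opQ (ε : k) :
    IsDualSystem (Γ := Γ) ε (vertexOpQ k Γ) (edgeOpQ ε) := by
  constructor
  · intro i
    refine end_quotient_ext fun m => ?_
    rw [Module.End.mul_apply, vertexOpQ_mkQ, vertexOpQ_mkQ, ← Module.End.mul_apply, vertexOp_sq]
    simp
  · intro i j _
    refine end_quotient_ext fun m => ?_
    rw [LinearMap.neg_apply, Module.End.mul_apply, Module.End.mul_apply]
    simp only [vertexOpQ_mkQ]
    rw [← Module.End.mul_apply, vertexOp_anticomm, ← map_neg]
    rfl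
  · rintro i ⟨e, he⟩ hi
    obtain ⟨j, rfl⟩ := Sym2.mem_iff_exists.mp hi
    refine end_quotient_ext fun m => ?_
    rw [Module.End.mul_apply, edgeOpQ_mkQ, vertexOpQ_mkQ, ← Module.End.mul_apply,
      vertexOp_mul_edgeOp ε he]
    simp
  · intro i j h
    refine end_quotient_ext fun m => ?_
    rw [LinearMap.smul_apply, Module.End.mul_apply, Module.End.mul_apply]
    simp only [vertexOpQ_mkQ, edgeOpQ_mkQ]
    rw [← Module.End.mul_apply, edgeOp_mul_vertexOp_right ε h, ← map_smul]
    rfl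
  · rintro ⟨⟨i, j⟩, h⟩ l hl
    have hl' := not_or.mp (mt Sym2.mem_iff.mpr hl)
    refine end_quotient_ext fun m => ?_
    rw [LinearMap.neg_apply, Module.End.mul_apply, Module.End.mul_apply]
    simp only [vertexOpQ_mkQ, edgeOpQ_mkQ]
    rw [← map_neg]
    exact congrArg _ (LinearMap.congr_fun (edgeOp_mul_vertexOp ε h hl'.1 hl'.2) m)
  · rintro ⟨⟨i, j⟩, h⟩
    refine end_quotient_ext fun m => ?_
    rw [Module.End.mul_apply]
    simp only [edgeOpQ_mkQ]
    exact (congrArg (triangleSpan k Γ).mkQ (LinearMap.congr_fun (edgeOp_sq ε h) m)).trans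
      (map_zero _)
  · intro i j l h h' hil
    refine end_quotient_ext fun m => ?_
    rw [LinearMap.smul_apply, Module.End.mul_apply, Module.End.mul_apply]
    simp only [vertexOpQ_mkQ, edgeOpQ_mkQ]
    rw [← map_smul]
    exact congrArg _ (LinearMap.congr_fun (edgeOp_mul_edgeOp ε h h' hil) m)
  · rintro ⟨⟨i, j⟩, h⟩ ⟨⟨l, m⟩, h'⟩ hd
    have hi := not_or.mp (mt Sym2.mem_iff.mpr (hd i (Sym2.mem_mk_left i j)))
    have hj := not_or.mp (mt Sym2.mem_iff.mpr (hd j (Sym2.mem_mk_right i j)))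
    refine end_quotient_ext fun q => ?_
    rw [LinearMap.neg_apply, Module.End.mul_apply, Module.End.mul_apply]
    simp only [edgeOpQ_mkQ]
    rw [← map_neg]
    exact congrArg _ (LinearMap.congr_fun (edgeOp_anticomm ε h h' hi.1 hi.2 hj.1 hj.2) q)
  · intro i j l hij hjl h h' h''
    refine end_quotient_ext fun m => ?_
    rw [LinearMap.add_apply, LinearMap.add_apply, Module.End.mul_apply, Module.End.mul_apply,
      Module.End.mul_apply]
    simp only [vertexOpQ_mkQ, edgeOpQ_mkQ]
    rw [← map_add, ← map_add, LinearMap.zero_apply, Submodule.mkQ_apply,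
      Submodule.Quotient.mk_eq_zero]
    have := LinearMap.congr_fun (Triangle.op_eq ε ⟨i, j, l, hij, hjl, h, h', h''⟩) m
    exact Set.mem_of_eq_of_mem this (op_mem_triangleSpan _ _)

variable (k Γ) in
/-- The product of the local normal form operators of all triangles. -/
noncomputable def normalForm : Module.End k (Fock k Γ) :=
  letI := Fintype.ofFinite (Triangle Γ)
  ((Finset.univ : Finset (Triangle Γ)).toList.map Triangle.reduce).prod

theorem prod_reduce_mul_op_of_notMem (hΓ : NoOverlappingTriangles Γ) (T : Triangle Γ)
    (l : List (Triangle Γ)) (hT : T ∉ l) :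
    (l.map (Triangle.reduce (k := k))).prod * T.op k =
      T.op k * (l.map (Triangle.reduce (k := k))).prod := by
  induction l with
  | nil => simp
  | cons U l ih =>
    simp only [List.mem_cons, not_or] at hT
    rw [List.map_cons, List.prod_cons, mul_assoc, ih hT.2, ← mul_assoc,
      Triangle.reduce_mul_op hΓ (Ne.symm hT.1), mul_assoc]

/-- `op` of T moves left through the factors of other triangles until it meets the factor of T,
which kills it. -/
theorem prod_reduce_mul_op (hΓ : NoOverlappingTriangles Γ) (T : Triangle Γ)
    (l : List (Triangle Γ)) (hT : T ∈ l) :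
    (l.map (Triangle.reduce (k := k))).prod * T.op k = 0 := by
  induction l with
  | nil => simp at hT
  | cons U l ih =>
    rw [List.map_cons, List.prod_cons, mul_assoc]
    by_cases hl : T ∈ l
    · rw [ih hl, mul_zero]
    · obtain rfl : T = U := (List.mem_cons.mp hT).resolve_right hl
      rw [prod_reduce_mul_op_of_notMem hΓ T l hl, ← mul_assoc, Triangle.reduce_mul_op_self,
        zero_mul]

theorem triangleSpan_le_ker_normalForm (hΓ : NoOverlappingTriangles Γ) :
    triangleSpan k Γ ≤ LinearMap.ker (normalForm k Γ) := by
  refine Submodule.span_le.mpr ?_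
  rintro _ ⟨T, m, rfl⟩
  rw [SetLike.mem_coe, LinearMap.mem_ker, ← Module.End.mul_apply, normalForm,
    prod_reduce_mul_op hΓ T _ (by simp), LinearMap.zero_apply]

/-- The sets of generators with pairwise disjoint supports which contain no edge `ab` together
with the vertex `c` of a triangle `a < b < c`. -/
def IsReduced (A : Finset (Fin n ⊕ Γ.edgeSet)) : Prop :=
  (∀ x ∈ A, ∀ y ∈ A, x ≠ y → Disjoint (support x) (support y)) ∧
    ∀ T : Triangle Γ, ¬ (Sum.inl T.c ∈ A ∧ Sum.inr T.edgeAB ∈ A)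

theorem normalForm_basis {A : Finset (Fin n ⊕ Γ.edgeSet)} (hA : IsReduced A) :
    normalForm k Γ (fockBasis k _ A) = fockBasis k _ A := by
  have : ∀ l : List (Triangle Γ),
      (l.map (Triangle.reduce (k := k))).prod (fockBasis k _ A) = fockBasis k _ A := by
    intro l
    induction l with
    | nil => rfl
    | cons U l ih =>
      rw [List.map_cons, List.prod_cons, Module.End.mul_apply, ih, U.reduce_basis (hA.2 U)]
  exact this _

/-- The vector of the Fock space obtained from an element of the quadratic dual by acting on the
vacuum and taking the normal form. -/
noncomputable def evalVacuum (hΓ : NoOverlappingTriangles Γ) (ε : k) :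
    QuadAlg (QuadAlg.dualRel (rel k Γ ε)) →ₗ[k] Fock k Γ :=
  (triangleSpan k Γ).liftQ (normalForm k Γ) (triangleSpan_le_ker_normalForm hΓ) ∘ₗ
    (LinearMap.applyₗ ((triangleSpan k Γ).mkQ (fockBasis k _ ∅))) ∘ₗ
      (isDualSystem_opQ ε).lift.toLinearMap

open scoped Classical in
theorem vertexOp_basis {i : Fin n} {A : Finset (Fin n ⊕ Γ.edgeSet)}
    (h : ∀ y ∈ A, Disjoint (support (Sum.inl i : Fin n ⊕ Γ.edgeSet)) (support y)) :
    ∃ c : kˣ, vertexOp k Γ i (fockBasis k _ A) = c • fockBasis k _ (insert (Sum.inl i) A) := by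
  refine ⟨⟨_, _, fockSign_mul_self rank (Sum.inl i) A, fockSign_mul_self rank (Sum.inl i) A⟩, ?_⟩
  rw [vertexOp, create_single h, Units.smul_def]

-- On a set disjoint from the edge both projections vanish, so the ε-correction is invisible. The
-- scalar is a sign, recorded as a unit because independence needs it to be invertible.
open scoped Classical in
theorem edgeOp_basis (ε : k) {e : Γ.edgeSet} {A : Finset (Fin n ⊕ Γ.edgeSet)}
    (h : ∀ y ∈ A, Disjoint (support (Sum.inr e)) (support y)) :
    ∃ c : kˣ, edgeOp ε e (fockBasis k _ A) = c • fockBasis k _ (insert (Sum.inr e) A) := by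
  refine ⟨⟨_, _, fockSign_mul_self rank (Sum.inr e) A, fockSign_mul_self rank (Sum.inr e) A⟩, ?_⟩
  have hp : ∀ i ∈ e.1, proj k Γ i (fockBasis k _ A) = 0 := by
    intro i hi
    refine touch_single_of_not ?_
    rintro ⟨b, hb, hib⟩
    exact Finset.disjoint_left.mp (h b hb) (by simpa [support] using hi) hib
  have h0 : edgeOp ε e (fockBasis k _ A) = edgeCreate k Γ e (fockBasis k _ A) := by
    obtain ⟨e, he⟩ := e
    induction e using Sym2.ind with | _ i j
    rw [edgeOp_mk ε he, LinearMap.add_apply, LinearMap.smul_apply, LinearMap.add_apply,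
      Module.End.mul_apply, Module.End.mul_apply, hp i (Sym2.mem_mk_left i j),
      hp j (Sym2.mem_mk_right i j)]
    simp
  rw [h0, edgeCreate, create_single h, Units.smul_def]

/-- The product of the generators in a list. -/
noncomputable def monomial (ε : k) (l : List (Fin n ⊕ Γ.edgeSet)) :
    QuadAlg (QuadAlg.dualRel (rel k Γ ε)) :=
  (l.map (dualGen ε)).prod

/-- The generators in the list have pairwise disjoint supports. -/
def ListDisjoint (l : List (Fin n ⊕ Γ.edgeSet)) : Prop :=
  l.Pairwise fun x y => Disjoint (support x) (support y)

open scoped Classical in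
theorem lift_monomial (ε : k) (l : List (Fin n ⊕ Γ.edgeSet)) (hl : ListDisjoint l) :
    ∃ c : kˣ, (isDualSystem_opQ ε).lift (monomial ε l)
      ((triangleSpan k Γ).mkQ (fockBasis k _ ∅)) =
        c • (triangleSpan k Γ).mkQ (fockBasis k _ l.toFinset) := by
  induction l with
  | nil => exact ⟨1, by simp [monomial]⟩
  | cons a l ih =>
    obtain ⟨h1, h2⟩ := List.pairwise_cons.mp hl
    obtain ⟨c, hc⟩ := ih h2
    have h1' : ∀ y ∈ l.toFinset, Disjoint (support a) (support y) := by simpa using h1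
    have e : (isDualSystem_opQ ε).lift (monomial ε (a :: l))
        ((triangleSpan k Γ).mkQ (fockBasis k _ ∅)) =
        Sum.elim (vertexOpQ k Γ) (edgeOpQ ε) a
          (c • (triangleSpan k Γ).mkQ (fockBasis k _ l.toFinset)) := by
      rw [monomial, List.map_cons, List.prod_cons, map_mul, Module.End.mul_apply,
        ← monomial, hc, IsDualSystem.lift_dualGen]
    rw [e, List.toFinset_cons, Units.smul_def, map_smul]
    rcases a with i | f
    · obtain ⟨c', hc'⟩ := vertexOp_basis (k := k) h1'
      refine ⟨c * c', ?_⟩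
      rw [Sum.elim_inl, vertexOpQ_mkQ, hc', Units.smul_def, Units.smul_def, map_smul, smul_smul,
        Units.val_mul]
    · obtain ⟨c', hc'⟩ := edgeOp_basis (k := k) ε h1'
      refine ⟨c * c', ?_⟩
      rw [Sum.elim_inr, edgeOpQ_mkQ, hc', Units.smul_def, Units.smul_def, map_smul, smul_smul,
        Units.val_mul]

theorem listDisjoint_toList {A : Finset (Fin n ⊕ Γ.edgeSet)}
    (hA : ∀ x ∈ A, ∀ y ∈ A, x ≠ y → Disjoint (support x) (support y)) :
    ListDisjoint A.toList :=
  A.nodup_toList.imp_of_mem fun {x y} hx hy hxy =>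
    hA x (Finset.mem_toList.mp hx) y (Finset.mem_toList.mp hy) hxy

/-- Acting on the vacuum builds the set A up to a unit, and the normal form fixes reduced basis
vectors, so the images are unit multiples of distinct basis vectors. -/
theorem linearIndependent_monomial (hΓ : NoOverlappingTriangles Γ) (ε : k) (d : ℕ) :
    LinearIndependent k (fun A : {A : Finset (Fin n ⊕ Γ.edgeSet) // IsReduced A ∧ A.card = d} =>
      monomial ε A.1.toList) := by
  classical
  have h : ∀ A : {A : Finset (Fin n ⊕ Γ.edgeSet) // IsReduced A ∧ A.card = d}, ∃ c : kˣ,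
      evalVacuum hΓ ε (monomial ε A.1.toList) = c • fockBasis k _ A.1 := by
    intro A
    obtain ⟨c, hc⟩ := lift_monomial ε A.1.toList (listDisjoint_toList A.2.1.1)
    refine ⟨c, ?_⟩
    rw [Finset.toList_toFinset] at hc
    rw [evalVacuum, LinearMap.comp_apply, LinearMap.comp_apply]
    have hc' : (LinearMap.applyₗ ((triangleSpan k Γ).mkQ (fockBasis k _ ∅)))
        ((isDualSystem_opQ ε).lift.toLinearMap (monomial ε A.1.toList)) =
        c • (triangleSpan k Γ).mkQ (fockBasis k _ A.1) := hc
    rw [hc', Units.smul_def, map_smul, Submodule.mkQ_apply, Submodule.liftQ_apply,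
      normalForm_basis A.2.1, Units.smul_def]
  choose c hc using h
  refine LinearIndependent.of_comp (evalVacuum hΓ ε) ?_
  have : (evalVacuum hΓ ε : _ → _) ∘ (fun A : {A : Finset (Fin n ⊕ Γ.edgeSet) //
      IsReduced A ∧ A.card = d} => monomial ε A.1.toList) =
      c • fun A : {A : Finset (Fin n ⊕ Γ.edgeSet) // IsReduced A ∧ A.card = d} =>
        fockBasis k _ A.1 := funext hc
  rw [this]
  exact ((fockBasis k _).linearIndependent.comp _ Subtype.val_injective).units_smul c

end GraphAlg

/-! ### Reduced monomials span each graded component. -/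

namespace GraphAlg

variable {k : Type*} [Field k] {n : ℕ} {Γ : SimpleGraph (Fin n)}

theorem IsDualSystem.anticomm {E : Type*} [Ring E] [Algebra k E] {ε : k} {x : Fin n → E}
    {y : Γ.edgeSet → E} (S : IsDualSystem ε x y) {a b : Fin n ⊕ Γ.edgeSet}
    (h : Disjoint (support a) (support b)) :
    Sum.elim x y a * Sum.elim x y b = (-1 : k) • (Sum.elim x y b * Sum.elim x y a) := by
  rw [neg_smul, one_smul]
  rcases a with i | e <;> rcases b with j | f
  · exact S.vertex_anti i j (by simpa [support_vertex] using h)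
  · have := S.edge_vertex_anti f i (by simpa [support] using h)
    simp only [Sum.elim_inl, Sum.elim_inr]
    rw [this, neg_neg]
  · exact S.edge_vertex_anti e j (by simpa [support] using h)
  · refine S.edge_edge_anti e f fun v hv hv' => ?_
    exact Finset.disjoint_left.mp h (by simpa [support] using hv) (by simpa [support] using hv')

theorem IsDualSystem.triangle_eq {E : Type*} [Ring E] [Algebra k E] {ε : k} {x : Fin n → E}
    {y : Γ.edgeSet → E} (S : IsDualSystem ε x y) (T : Triangle Γ) :
    x T.c * y T.edgeAB = (-1 : k) • (x T.a * y T.edgeBC + x T.b * y T.edgeAC) := by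
  rw [neg_smul, one_smul]
  exact eq_neg_of_add_eq_zero_right
    (S.triangle T.a T.b T.c T.hab T.hbc T.adj_ab T.adj_bc T.adj_ac)

theorem dualGen_anticomm (ε : k) {a b : Fin n ⊕ Γ.edgeSet}
    (h : Disjoint (support a) (support b)) :
    dualGen ε a * dualGen ε b = (-1 : k) • (dualGen ε b * dualGen ε a) := by
  have := (isDualSystem_dualGen (Γ := Γ) ε).anticomm h
  rcases a with i | e <;> rcases b with j | f <;> exact this

theorem exists_perm_cons {α : Type*} {a : α} {l : List α} (h : a ∈ l) :
    ∃ l', l.Perm (a :: l') := by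
  obtain ⟨s, t, rfl⟩ := List.append_of_mem h
  exact ⟨s ++ t, List.perm_middle⟩

theorem ListDisjoint.perm {l l' : List (Fin n ⊕ Γ.edgeSet)} (h : l.Perm l')
    (hl : ListDisjoint l) : ListDisjoint l' :=
  h.pairwise hl fun {_ _} hxy => hxy.symm

theorem ListDisjoint.nodup {l : List (Fin n ⊕ Γ.edgeSet)} (hl : ListDisjoint l) : l.Nodup :=
  hl.imp fun {_ _} hxy => ne_of_disjoint_support support_nonempty hxy

theorem monomial_cons (ε : k) (a : Fin n ⊕ Γ.edgeSet) (l : List (Fin n ⊕ Γ.edgeSet)) :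
    monomial ε (a :: l) = dualGen ε a * monomial ε l := by
  rw [monomial, List.map_cons, List.prod_cons, monomial]

theorem monomial_perm (ε : k) {l l' : List (Fin n ⊕ Γ.edgeSet)} (h : l.Perm l')
    (hl : ListDisjoint l) : ∃ c : k, monomial ε l = c • monomial ε l' := by
  induction h with
  | nil => exact ⟨1, (one_smul _ _).symm⟩
  | cons a _ ih =>
    obtain ⟨c, hc⟩ := ih (List.pairwise_cons.mp hl).2
    exact ⟨c, by rw [monomial_cons, monomial_cons, hc, mul_smul_comm]⟩
  | swap a b l =>
    have hab : Disjoint (support b) (support a) := (List.pairwise_cons.mp hl).1 a (by simp)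
    refine ⟨-1, ?_⟩
    rw [monomial_cons, monomial_cons, monomial_cons, monomial_cons, ← mul_assoc, ← mul_assoc,
      dualGen_anticomm ε hab, smul_mul_assoc]
  | trans h1 _ ih1 ih2 =>
    obtain ⟨c, hc⟩ := ih1 hl
    obtain ⟨c', hc'⟩ := ih2 (hl.perm h1)
    exact ⟨c * c', by rw [hc, hc', smul_smul]⟩

variable (Γ) in
/-- The span of the reduced monomials of degree `d`. -/
noncomputable def reducedSpan (ε : k) (d : ℕ) :
    Submodule k (QuadAlg (QuadAlg.dualRel (rel k Γ ε))) :=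
  Submodule.span k (Set.range
    fun A : {A : Finset (Fin n ⊕ Γ.edgeSet) // IsReduced A ∧ A.card = d} =>
      monomial ε A.1.toList)

theorem monomial_mem_of_perm (ε : k) {d : ℕ} {l l' : List (Fin n ⊕ Γ.edgeSet)} (h : l.Perm l')
    (hl : ListDisjoint l) (hm : monomial ε l' ∈ reducedSpan Γ ε d) :
    monomial ε l ∈ reducedSpan Γ ε d := by
  obtain ⟨c, hc⟩ := monomial_perm ε h hl
  rw [hc]
  exact Submodule.smul_mem _ _ hm

/-- The sum of the vertices in a list of generators. -/
def vertexWeight (l : List (Fin n ⊕ Γ.edgeSet)) : ℕ :=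
  (l.map (Sum.elim (fun i : Fin n => (i : ℕ)) fun _ => 0)).sum

/-- Induction on the sum of the vertices that occur as generators. Rewriting x_c y_ab as -(x_a y_bc
+ x_b y_ac) replaces c by a smaller vertex and keeps the degree and the occupied vertices, so the
new monomials are again disjoint and of smaller weight. -/
theorem monomial_mem_reducedSpan (ε : k) (l : List (Fin n ⊕ Γ.edgeSet)) (hl : ListDisjoint l) :
    monomial ε l ∈ reducedSpan Γ ε l.length := by
  classical
  induction hw : vertexWeight l using Nat.strong_induction_on generalizing l with
  | _ w ih =>
  have hperm : l.toFinset.toList.Perm l := List.toFinset_toList hl.nodup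
  by_cases hred : IsReduced l.toFinset
  · refine monomial_mem_of_perm ε hperm.symm hl (Submodule.subset_span ⟨⟨l.toFinset, hred, ?_⟩, rfl⟩)
    exact List.toFinset_card_of_nodup hl.nodup
  · have hdis : ∀ x ∈ l.toFinset, ∀ y ∈ l.toFinset, x ≠ y →
        Disjoint (support x) (support y) := by
      intro x hx y hy hxy
      exact List.Pairwise.forall hl (List.mem_toFinset.mp hx) (List.mem_toFinset.mp hy) hxy
    obtain ⟨T, hc, hab⟩ : ∃ T : Triangle Γ,
        Sum.inl T.c ∈ l ∧ Sum.inr T.edgeAB ∈ l := by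
      by_contra hcon
      exact hred ⟨hdis, fun T hT => hcon ⟨T, by simpa using hT.1, by simpa using hT.2⟩⟩
    obtain ⟨l1, p1⟩ := exists_perm_cons hc
    have hab1 : Sum.inr T.edgeAB ∈ l1 := by simpa using p1.subset hab
    obtain ⟨l2, p1'⟩ := exists_perm_cons hab1
    have p2 : l.Perm (Sum.inl T.c :: Sum.inr T.edgeAB :: l2) := p1.trans (p1'.cons _)
    have hl2 := hl.perm p2
    have hlen : l.length = l2.length + 2 := by simpa using p2.length_eq
    have hwt : vertexWeight l = T.c + vertexWeight l2 := by
      have := (p2.map (Sum.elim (fun i : Fin n => (i : ℕ)) fun _ => 0)).sum_eq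
      simpa [vertexWeight] using this
    obtain ⟨hl2a, hl2b⟩ := List.pairwise_cons.mp hl2
    obtain ⟨hl2c, hl2d⟩ := List.pairwise_cons.mp hl2b
    have hvert : ∀ y ∈ l2, Disjoint T.vertices (support y) := by
      intro y hy
      have h1 := hl2a y (by simp [hy])
      have h2 := hl2c y hy
      rw [Triangle.support_edgeAB] at h2
      rw [support_vertex] at h1
      simp only [Finset.disjoint_insert_left, Finset.disjoint_singleton_left] at h1 h2
      simp only [Triangle.vertices, Finset.disjoint_insert_left, Finset.disjoint_singleton_left]
      tauto
    have hnew : ∀ (i : Fin n) (e : Γ.edgeSet), i < T.c → i ∈ T.vertices →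
        support (Sum.inr e) ⊆ T.vertices → i ∉ support (Sum.inr e) →
        monomial ε (Sum.inl i :: Sum.inr e :: l2) ∈ reducedSpan Γ ε l.length := by
      intro i e hi hiT heT hie
      have hd : ListDisjoint (Sum.inl i :: Sum.inr e :: l2) := by
        refine List.pairwise_cons.mpr ⟨fun y hy => ?_, List.pairwise_cons.mpr
          ⟨fun y hy => Finset.disjoint_of_subset_left heT (hvert y hy), hl2d⟩⟩
        rcases List.mem_cons.mp hy with rfl | hy
        · simpa [support_vertex] using hie
        · exact Finset.disjoint_of_subset_left (by simpa [support_vertex] using hiT) (hvert y hy)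
      have hlen' : l.length = (Sum.inl i :: Sum.inr e :: l2).length := by simp [hlen]
      rw [hlen']
      refine ih _ ?_ _ hd rfl
      rw [← hw, hwt]
      simpa [vertexWeight] using hi
    refine monomial_mem_of_perm ε p2 hl ?_
    have hm : monomial ε (Sum.inl T.c :: Sum.inr T.edgeAB :: l2) =
        (-1 : k) • (monomial ε (Sum.inl T.a :: Sum.inr T.edgeBC :: l2) +
          monomial ε (Sum.inl T.b :: Sum.inr T.edgeAC :: l2)) := by
      simp only [monomial_cons, ← mul_assoc, ← add_mul]
      rw [(isDualSystem_dualGen (Γ := Γ) ε).triangle_eq T, smul_mul_assoc]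
    have hab := T.hab
    have hbc := T.hbc
    have hac := hab.trans hbc
    rw [hm]
    refine Submodule.smul_mem _ _ (add_mem (hnew _ _ hac ?_ ?_ ?_) (hnew _ _ hbc ?_ ?_ ?_))
    · simp [Triangle.vertices]
    · simp [Triangle.vertices, Triangle.support_edgeBC]
    · simp [Triangle.support_edgeBC, hab.ne, hac.ne]
    · simp [Triangle.vertices]
    · simp [Triangle.vertices, Triangle.support_edgeAC, Finset.insert_subset_iff]
    · simp [Triangle.support_edgeAC, hab.ne', hbc.ne]

theorem vertex_mul_monomial_mem (ε : k) (i : Fin n) (l : List (Fin n ⊕ Γ.edgeSet))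
    (hl : ListDisjoint l) :
    dualGen ε (Sum.inl i) * monomial ε l ∈ reducedSpan Γ ε (l.length + 1) := by
  classical
  by_cases h : ∀ b ∈ l, Disjoint (support (Sum.inl i : Fin n ⊕ Γ.edgeSet)) (support b)
  · rw [← monomial_cons]
    exact monomial_mem_reducedSpan ε (Sum.inl i :: l) (List.pairwise_cons.mpr ⟨h, hl⟩)
  · push Not at h
    obtain ⟨b, hb, hib⟩ := h
    have hib : i ∈ support b := by simpa [support_vertex] using hib
    obtain ⟨l', hperm⟩ := exists_perm_cons hb
    have h0 : dualGen ε (Sum.inl i) * monomial ε (b :: l') = 0 := by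
      have S := isDualSystem_dualGen (Γ := Γ) ε
      rw [monomial_cons, ← mul_assoc]
      have : dualGen ε (Sum.inl i) * dualGen ε b = 0 := by
        rcases b with j | e
        · obtain rfl : i = j := by simpa [support_vertex] using hib
          exact S.vertex_sq i
        · exact S.vertex_edge_zero i e (by simpa [support] using hib)
      rw [this, zero_mul]
    obtain ⟨c, hc⟩ := monomial_perm ε hperm hl
    rw [hc, mul_smul_comm, h0, smul_zero]
    exact zero_mem _

/-- If an edge e = {v, w} meets a factor b at v, move b to the front: y_e b = ε x_w b turns the edge
into a vertex, and the vertex case applies. -/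
theorem dualGen_mul_monomial_mem (ε : k) (a : Fin n ⊕ Γ.edgeSet)
    (l : List (Fin n ⊕ Γ.edgeSet)) (hl : ListDisjoint l) :
    dualGen ε a * monomial ε l ∈ reducedSpan Γ ε (l.length + 1) := by
  classical
  rcases a with i | e
  · exact vertex_mul_monomial_mem ε i l hl
  by_cases h : ∀ b ∈ l, Disjoint (support (Sum.inr e)) (support b)
  · rw [← monomial_cons]
    exact monomial_mem_reducedSpan ε (Sum.inr e :: l) (List.pairwise_cons.mpr ⟨h, hl⟩)
  · push Not at h
    obtain ⟨b, hb, heb⟩ := h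
    obtain ⟨v, hve, hvb⟩ := Finset.not_disjoint_iff.mp heb
    have S := isDualSystem_dualGen (Γ := Γ) ε
    have hve' : v ∈ e.1 := by simpa [support] using hve
    have key : ∃ w : Fin n, dualGen ε (Sum.inr e) * dualGen ε b =
        ε • (dualGen ε (Sum.inl w) * dualGen ε b) := by
      obtain ⟨e, he⟩ := e
      obtain ⟨w, rfl⟩ := Sym2.mem_iff_exists.mp hve'
      refine ⟨w, ?_⟩
      have he' : Γ.Adj w v := Γ.adj_symm he
      have hne := Γ.ne_of_adj he'
      have hee : (⟨s(v, w), he⟩ : Γ.edgeSet) = ⟨s(w, v), he'⟩ := Subtype.ext Sym2.eq_swap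
      rw [hee]
      rcases b with j | ⟨f, hf⟩
      · obtain rfl : v = j := by simpa [support_vertex] using hvb
        exact S.edge_vertex w v he'
      · have hvf : v ∈ f := by simpa [support] using hvb
        obtain ⟨l, rfl⟩ := Sym2.mem_iff_exists.mp hvf
        -- Here the factor is the edge e itself, and both sides of the claimed identity vanish.
        by_cases hwl : w = l
        · subst hwl
          have h1 := S.edge_sq ⟨s(w, v), he'⟩
          have h2 := S.vertex_edge_zero w ⟨s(v, w), hf⟩ (by simp)
          rw [h2, smul_zero, ← hee] at *
          exact h1
        · exact S.edge_edge w v l he' hf hwl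
    obtain ⟨w, hw⟩ := key
    have hx := vertex_mul_monomial_mem ε w l hl
    have hswap : dualGen ε (Sum.inr e) * monomial ε l =
        ε • (dualGen ε (Sum.inl w) * monomial ε l) := by
      obtain ⟨l', hperm⟩ := exists_perm_cons hb
      have h1 : dualGen ε (Sum.inr e) * monomial ε (b :: l') =
          ε • (dualGen ε (Sum.inl w) * monomial ε (b :: l')) := by
        rw [monomial_cons, ← mul_assoc, hw, smul_mul_assoc, mul_assoc]
      obtain ⟨c, hc⟩ := monomial_perm ε hperm hl
      rw [hc, mul_smul_comm, mul_smul_comm, h1, smul_comm]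
    rw [hswap]
    exact Submodule.smul_mem _ _ hx

theorem isReduced_empty : IsReduced (∅ : Finset (Fin n ⊕ Γ.edgeSet)) := by
  simp [IsReduced]

theorem dual_eq_sum_lapply {ι : Type*} [Fintype ι] (φ : Module.Dual k (ι →₀ k)) :
    φ = ∑ a, φ (Finsupp.single a 1) • (Finsupp.lapply a : Module.Dual k (ι →₀ k)) := by
  classical
  refine Finsupp.lhom_ext' fun a => LinearMap.ext_ring ?_
  simp [Finsupp.single_apply]

theorem gen_eq_sum [Fintype Γ.edgeSet] (ε : k) (φ : Module.Dual k (Gens k Γ)) :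
    QuadAlg.gen (QuadAlg.dualRel (rel k Γ ε)) φ =
      ∑ a, φ (Finsupp.single a 1) • dualGen ε a := by
  conv_lhs => rw [dual_eq_sum_lapply φ]
  rw [map_sum]
  simp only [map_smul]
  rfl

/-- The reduced spans contain 1 in degree zero and are carried into the next degree by left
multiplication with generators, so they exhaust the components. -/
theorem component_eq_reducedSpan (ε : k) (d : ℕ) :
    QuadAlg.component (QuadAlg.dualRel (rel k Γ ε)) d = reducedSpan Γ ε d := by
  classical
  apply le_antisymm
  · induction d with
    | zero =>
      rw [QuadAlg.component, pow_zero, Submodule.one_eq_span, Submodule.span_le,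
        Set.singleton_subset_iff]
      exact Submodule.subset_span ⟨⟨∅, isReduced_empty, rfl⟩, by simp [monomial]⟩
    | succ d ih =>
      rw [QuadAlg.component, pow_succ', Submodule.mul_le]
      rintro _ ⟨φ, rfl⟩ m hm
      have hm' : m ∈ reducedSpan Γ ε d := ih hm
      rw [gen_eq_sum, Finset.sum_mul]
      refine sum_mem fun a _ => ?_
      rw [smul_mul_assoc]
      refine Submodule.smul_mem _ _ ?_
      have hle : reducedSpan Γ ε d ≤
          (reducedSpan Γ ε (d + 1)).comap (LinearMap.mulLeft k (dualGen ε a)) := by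
        refine Submodule.span_le.mpr ?_
        rintro _ ⟨⟨A, hA, hd⟩, rfl⟩
        have := dualGen_mul_monomial_mem ε a A.toList (listDisjoint_toList hA.1)
        rw [Finset.length_toList, hd] at this
        exact this
      exact hle hm'
  · refine Submodule.span_le.mpr ?_
    rintro _ ⟨⟨A, hA, rfl⟩, rfl⟩
    have : ∀ l : List (Fin n ⊕ Γ.edgeSet), monomial ε l ∈
        QuadAlg.component (QuadAlg.dualRel (rel k Γ ε)) l.length := by
      intro l
      induction l with
      | nil =>
        rw [QuadAlg.component, List.length_nil, pow_zero]
        exact Submodule.one_le.mp le_rfl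
      | cons a l ih =>
        rw [monomial_cons, QuadAlg.component, List.length_cons, pow_succ']
        exact Submodule.mul_mem_mul ⟨_, rfl⟩ ih
    simpa using this A.toList

theorem finrank_component (hΓ : NoOverlappingTriangles Γ) (ε : k) (d : ℕ) :
    Module.finrank k (QuadAlg.component (QuadAlg.dualRel (rel k Γ ε)) d) =
      Nat.card {A : Finset (Fin n ⊕ Γ.edgeSet) // IsReduced A ∧ A.card = d} := by
  classical
  rw [component_eq_reducedSpan, reducedSpan, Nat.card_eq_fintype_card]
  exact finrank_span_eq_card (linearIndependent_monomial hΓ ε d)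

end GraphAlg

/-! ### Counting reduced sets by matchings and admissible vertices. -/

namespace GraphAlg

variable {n : ℕ} {Γ : SimpleGraph (Fin n)}

variable (Γ) in
/-- The sets of pairwise disjoint edges. -/
def IsEdgeMatching (W : Finset (Sym2 (Fin n))) : Prop :=
  (∀ e ∈ W, e ∈ Γ.edgeSet) ∧ ∀ e ∈ W, ∀ f ∈ W, e ≠ f → ∀ v, v ∈ e → v ∉ f

theorem mem_matchings {p : ℕ} {W : Finset (Sym2 (Fin n))} :
    W ∈ matchings Γ p ↔ W.card = p ∧ IsEdgeMatching Γ W := by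
  simp [matchings, IsEdgeMatching]

theorem mem_admissible {W : Finset (Sym2 (Fin n))} {m : Fin n} :
    m ∈ admissible Γ W ↔ (∀ e ∈ W, m ∉ e) ∧
      ∀ i j : Fin n, s(i, j) ∈ W → j < i → m < i ∨ ¬ Γ.Adj m i ∨ ¬ Γ.Adj m j := by
  simp [admissible]

theorem IsEdgeMatching.card_biUnion {W : Finset (Sym2 (Fin n))} (hW : IsEdgeMatching Γ W) :
    (W.biUnion Sym2.toFinset).card = 2 * W.card := by
  rw [Finset.card_biUnion, Finset.sum_congr rfl (g := fun _ => 2), Finset.sum_const, smul_eq_mul,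
    mul_comm]
  · intro e he
    exact Sym2.card_toFinset_of_not_isDiag _ (Γ.not_isDiag_of_mem_edgeSet (hW.1 e he))
  · intro e he f hf hef
    refine Finset.disjoint_left.mpr fun v hv hv' => ?_
    exact hW.2 e he f hf hef v (by simpa using hv) (by simpa using hv')

theorem IsEdgeMatching.two_mul_card_le {W : Finset (Sym2 (Fin n))} (hW : IsEdgeMatching Γ W) :
    2 * W.card ≤ n := by
  rw [← hW.card_biUnion]
  exact (Finset.card_le_univ _).trans (by simp)

/-- Without triangles the adjacency condition is automatic, and the admissible vertices are those
the matching leaves uncovered. -/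
theorem IsEdgeMatching.card_admissible {W : Finset (Sym2 (Fin n))} (hW : IsEdgeMatching Γ W)
    (hΓ : Γ.CliqueFree 3) : (admissible Γ W).card = n - 2 * W.card := by
  have : admissible Γ W = (W.biUnion Sym2.toFinset)ᶜ := by
    ext m
    rw [mem_admissible, Finset.mem_compl, Finset.mem_biUnion]
    simp only [Sym2.mem_toFinset, not_exists, not_and, and_iff_left_iff_imp]
    intro _ i j hij _
    by_contra hcon
    push Not at hcon
    have hadj : Γ.Adj i j := hW.1 _ hij
    exact hΓ {m, i, j} (SimpleGraph.is3Clique_triple_iff.mpr ⟨hcon.2.1, hcon.2.2, hadj⟩)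
  rw [this, Finset.card_compl, hW.card_biUnion, Fintype.card_fin]

/-- The set of edges in a set of generators. -/
def edgePart (A : Finset (Fin n ⊕ Γ.edgeSet)) : Finset (Sym2 (Fin n)) :=
  A.toRight.map (Function.Embedding.subtype _)

theorem mem_edgePart {A : Finset (Fin n ⊕ Γ.edgeSet)} {e : Sym2 (Fin n)} :
    e ∈ edgePart A ↔ ∃ h : e ∈ Γ.edgeSet, Sum.inr ⟨e, h⟩ ∈ A := by
  simp [edgePart]

theorem card_edgePart_add (A : Finset (Fin n ⊕ Γ.edgeSet)) :
    (edgePart A).card + A.toLeft.card = A.card := by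
  rw [edgePart, Finset.card_map, add_comm]
  exact Finset.card_toLeft_add_card_toRight

/-- A forbidden pair (c, ab) is a vertex m = c above both ends of an edge with i = b and j = a,
which is precisely what admissibility excludes. -/
theorem isReduced_iff (A : Finset (Fin n ⊕ Γ.edgeSet)) :
    IsReduced A ↔ IsEdgeMatching Γ (edgePart A) ∧ A.toLeft ⊆ admissible Γ (edgePart A) := by
  constructor
  · rintro ⟨h1, h2⟩
    refine ⟨⟨?_, ?_⟩, ?_⟩
    · intro e he
      exact (mem_edgePart.mp he).1
    · intro e he f hf hef v hve hvf
      obtain ⟨he', heA⟩ := mem_edgePart.mp he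
      obtain ⟨hf', hfA⟩ := mem_edgePart.mp hf
      have := h1 _ heA _ hfA (by simpa using hef)
      exact Finset.disjoint_left.mp this (by simpa [support] using hve)
        (by simpa [support] using hvf)
    · intro m hm
      rw [Finset.mem_toLeft] at hm
      refine mem_admissible.mpr ⟨?_, ?_⟩
      · intro e he
        obtain ⟨he', heA⟩ := mem_edgePart.mp he
        have := h1 _ hm _ heA (by simp)
        simpa [support] using this
      · intro i j hij hji
        obtain ⟨hij', hijA⟩ := mem_edgePart.mp hij
        by_contra hcon
        push Not at hcon
        obtain ⟨hmi, hadj, hadj'⟩ := hcon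
        -- Negating m < i only gives i ≤ m; adjacency rules out equality.
        have hlt : i < m := lt_of_le_of_ne hmi (Γ.ne_of_adj hadj).symm
        refine h2 ⟨j, i, m, hji, hlt, Γ.adj_symm hij', hadj.symm, hadj'.symm⟩ ⟨hm, ?_⟩
        have : (⟨s(j, i), Γ.adj_symm hij'⟩ : Γ.edgeSet) = ⟨s(i, j), hij'⟩ :=
          Subtype.ext Sym2.eq_swap
        simpa only [Triangle.edgeAB, this] using hijA
  · rintro ⟨⟨_, h1⟩, h2⟩
    have hadm : ∀ m, Sum.inl m ∈ A → m ∈ admissible Γ (edgePart A) := fun m hm =>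
      h2 (Finset.mem_toLeft.mpr hm)
    refine ⟨?_, ?_⟩
    · rintro (i | ⟨e, he⟩) hx (j | ⟨f, hf⟩) hy hxy
      · simpa [support] using hxy
      · simpa [support] using (mem_admissible.mp (hadm i hx)).1 f (mem_edgePart.mpr ⟨hf, hy⟩)
      · simpa [support] using (mem_admissible.mp (hadm j hy)).1 e (mem_edgePart.mpr ⟨he, hx⟩)
      · refine Finset.disjoint_left.mpr fun v hv hv' => ?_
        exact h1 e (mem_edgePart.mpr ⟨he, hx⟩) f (mem_edgePart.mpr ⟨hf, hy⟩) (by simpa using hxy) v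
          (by simpa [support] using hv) (by simpa [support] using hv')
    · rintro T ⟨hc, hab⟩
      have hmem : s(T.b, T.a) ∈ edgePart A := by
        rw [Sym2.eq_swap]
        exact mem_edgePart.mpr ⟨T.adj_ab, hab⟩
      rcases (mem_admissible.mp (hadm _ hc)).2 T.b T.a hmem T.hab with h | h | h
      · exact h.not_gt T.hbc
      · exact h T.adj_bc.symm
      · exact h T.adj_ac.symm

-- Splitting A into its edges W and vertices S is a bijection onto matchings with a subset of their
-- admissible vertices, and (1 + x)^r is the generating function of the subsets of an r-element set.
-- The range up to n / 2 loses nothing, since a matching covers 2p ≤ n vertices.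
open scoped Classical in
theorem sum_isReduced {R : Type*} [CommSemiring R] (x : R) :
    ∑ A : Finset (Fin n ⊕ Γ.edgeSet) with IsReduced A, x ^ A.card =
      ∑ p ∈ Finset.range (n / 2 + 1), x ^ p *
        ∑ W ∈ matchings Γ p, (1 + x) ^ (admissible Γ W).card := by
  have h1 : ∀ W ∈ (Finset.univ.filter fun W : Finset (Sym2 (Fin n)) => IsEdgeMatching Γ W),
      W.card ∈ Finset.range (n / 2 + 1) := by
    intro W hW
    have := (Finset.mem_filter.mp hW).2.two_mul_card_le
    rw [Finset.mem_range]
    omega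
  have h2 : ∑ p ∈ Finset.range (n / 2 + 1), x ^ p *
      ∑ W ∈ matchings Γ p, (1 + x) ^ (admissible Γ W).card =
      ∑ W : Finset (Sym2 (Fin n)) with IsEdgeMatching Γ W,
        x ^ W.card * (1 + x) ^ (admissible Γ W).card := by
    rw [← Finset.sum_fiberwise_of_maps_to h1]
    refine Finset.sum_congr rfl fun p _ => ?_
    rw [Finset.mul_sum]
    refine Finset.sum_congr ?_ fun W hW => ?_
    · ext W
      simp [mem_matchings, and_comm]
    · rw [(Finset.mem_filter.mp hW).2]
  have h3 : ∀ W : Finset (Sym2 (Fin n)), x ^ W.card * (1 + x) ^ (admissible Γ W).card =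
      ∑ S ∈ (admissible Γ W).powerset, x ^ (W.card + S.card) := by
    intro W
    rw [add_comm 1 x, ← Finset.sum_pow_mul_eq_add_pow, Finset.mul_sum]
    simp [pow_add]
  rw [h2, Finset.sum_congr rfl fun W _ => h3 W, Finset.sum_sigma']
  refine Finset.sum_bij' (fun A _ => ⟨edgePart A, A.toLeft⟩)
    (fun q _ => q.2.disjSum (q.1.subtype fun e => e ∈ Γ.edgeSet)) ?_ ?_ ?_ ?_ ?_
  · intro A hA
    have := (isReduced_iff A).mp (Finset.mem_filter.mp hA).2
    simp [this.1, this.2]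
  · rintro ⟨W, S⟩ hq
    simp only [Finset.mem_sigma, Finset.mem_filter, Finset.mem_univ, true_and,
      Finset.mem_powerset] at hq
    have hW : edgePart (S.disjSum (W.subtype fun e => e ∈ Γ.edgeSet)) = W := by
      ext e
      simp only [mem_edgePart, Finset.inr_mem_disjSum, Finset.mem_subtype]
      exact ⟨fun h => h.2, fun h => ⟨hq.1.1 e h, h⟩⟩
    simp only [Finset.mem_filter, Finset.mem_univ, true_and]
    rw [isReduced_iff, hW, Finset.toLeft_disjSum]
    exact hq
  · intro A _
    ext a
    rcases a with i | ⟨e, he⟩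
    · simp
    · simp [mem_edgePart, he]
  · rintro ⟨W, S⟩ hq
    simp only [Finset.mem_sigma, Finset.mem_filter, Finset.mem_univ, true_and,
      Finset.mem_powerset] at hq
    have hW : edgePart (S.disjSum (W.subtype fun e => e ∈ Γ.edgeSet)) = W := by
      ext e
      simp only [mem_edgePart, Finset.inr_mem_disjSum, Finset.mem_subtype]
      exact ⟨fun h => h.2, fun h => ⟨hq.1.1 e h, h⟩⟩
    simp only [hW, Finset.toLeft_disjSum]
  · intro A _
    rw [card_edgePart_add]

theorem hilbertSeries_dualRel_rel {k : Type*} [Field k] (hΓ : NoOverlappingTriangles Γ) (ε : k) :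
    QuadAlg.hilbertSeries (QuadAlg.dualRel (rel k Γ ε)) =
      ((∑ p ∈ Finset.range (n / 2 + 1), Polynomial.X ^ p *
          ∑ W ∈ matchings Γ p, (1 + Polynomial.X) ^ (admissible Γ W).card : Polynomial ℕ) :
        PowerSeries ℕ) := by
  classical
  -- With x the polynomial variable, the coefficient of x^d in the sum over reduced sets counts
  -- those of cardinality d, which is the dimension of the component.
  rw [← sum_isReduced]
  ext d
  rw [QuadAlg.hilbertSeries, PowerSeries.coeff_mk, Polynomial.coeff_coe, finrank_component hΓ,
    Polynomial.finsetSum_coeff, Nat.card_eq_fintype_card, Fintype.card_subtype]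
  simp only [Polynomial.coeff_X_pow]
  rw [Finset.sum_boole, Finset.filter_filter]
  simp [eq_comm]

theorem sum_matchings_of_cliqueFree (hΓ : Γ.CliqueFree 3) :
    (∑ p ∈ Finset.range (n / 2 + 1), Polynomial.X ^ p *
      ∑ W ∈ matchings Γ p, (1 + Polynomial.X) ^ (admissible Γ W).card : Polynomial ℕ) =
    ∑ p ∈ Finset.range (n / 2 + 1), ((matchings Γ p).card : Polynomial ℕ) *
      Polynomial.X ^ p * (1 + Polynomial.X) ^ (n - 2 * p) := by
  refine Finset.sum_congr rfl fun p _ => ?_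
  have : ∀ W ∈ matchings Γ p, (1 + Polynomial.X : Polynomial ℕ) ^ (admissible Γ W).card =
      (1 + Polynomial.X) ^ (n - 2 * p) := by
    intro W hW
    obtain ⟨hc, hm⟩ := mem_matchings.mp hW
    rw [hm.card_admissible hΓ, hc]
  rw [Finset.sum_congr rfl this, Finset.sum_const, nsmul_eq_mul]
  ring

end GraphAlg

theorem proposition4p5 (k : Type*) [Field k] (n : ℕ) (Γ : SimpleGraph (Fin n))
    (hΓ : GraphAlg.NoOverlappingTriangles Γ) :
    (QuadAlg.hilbertSeries (QuadAlg.dualRel (GraphAlg.relQ k Γ)) =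
        ((∑ p ∈ Finset.range (n / 2 + 1), Polynomial.X ^ p *
          ∑ W ∈ GraphAlg.matchings Γ p,
            (1 + Polynomial.X) ^ (GraphAlg.admissible Γ W).card : Polynomial ℕ) :
          PowerSeries ℕ) ∧
      QuadAlg.hilbertSeries (QuadAlg.dualRel (GraphAlg.relB k Γ)) =
        ((∑ p ∈ Finset.range (n / 2 + 1), Polynomial.X ^ p *
          ∑ W ∈ GraphAlg.matchings Γ p,
            (1 + Polynomial.X) ^ (GraphAlg.admissible Γ W).card : Polynomial ℕ) :
          PowerSeries ℕ)) ∧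
    (Γ.CliqueFree 3 →
      QuadAlg.hilbertSeries (QuadAlg.dualRel (GraphAlg.relQ k Γ)) =
        ((∑ p ∈ Finset.range (n / 2 + 1), ((GraphAlg.matchings Γ p).card : Polynomial ℕ) *
          Polynomial.X ^ p * (1 + Polynomial.X) ^ (n - 2 * p) : Polynomial ℕ) :
          PowerSeries ℕ) ∧
      QuadAlg.hilbertSeries (QuadAlg.dualRel (GraphAlg.relB k Γ)) =
        ((∑ p ∈ Finset.range (n / 2 + 1), ((GraphAlg.matchings Γ p).card : Polynomial ℕ) *
          Polynomial.X ^ p * (1 + Polynomial.X) ^ (n - 2 * p) : Polynomial ℕ) :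
          PowerSeries ℕ)) := by
  rw [GraphAlg.relQ_eq_rel, GraphAlg.relB_eq_rel, GraphAlg.hilbertSeries_dualRel_rel hΓ,
    GraphAlg.hilbertSeries_dualRel_rel hΓ]
  refine ⟨⟨rfl, rfl⟩, fun h => ?_⟩
  rw [GraphAlg.sum_matchings_of_cliqueFree h]
  exact ⟨rfl, rfl⟩
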